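/- Let $R$ be a commutative ring and $\mathcal C$ a category. A *cohomology* on $\mathcal C$ with values in an abelian $R$-linear category $\mathcal B$ is a family $\{H^i\}_{i\in\mathbb N}$ of contravariant functors $H^i:\mathcal C\to\mathcal B$; it can be pushed forward along exact $R$-linear functors. Let $\mathcal A(\mathcal C)$ be the free abelian $R$-linear category on $\mathcal C^{op}\times\mathbb N$ ($\mathbb N$ discrete) and let $U$ be the universal cohomology with values in $\mathcal A(\mathcal C)$; for each cohomology $H$ with values in $\mathcal B$ let $F_H:\mathcal A(\mathcal C)\to\mathcal B$ be the exact $R$-linear functor, unique up to isomorphism, such that the push-forward $(F_H)_*U$ is isomorphic to $H$. Let a distinguished class of arrows of $\mathcal C$, closed under composition, be given. Its members $Y\to X$ are called pairs, written $(X,Y)$; morphisms of pairs are the commutative squares in $\mathcal C$. A *relative cohomology* with values in $\mathcal B$ is a family of contravariant functors $\{H^i\}_{i\in\mathbb N}$ from pairs to $\mathcal B$, together with boundary morphisms $\partial^i:H^i(Y,Z)\to H^{i+1}(X,Y)$ for all composable distinguished arrows $Z\to Y\to X$, natural with respect to morphisms of such triples, and such that for every triple the long sequence $$0\to H^0(X,Y)\to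 H^0(X,Z)\to H^0(Y,Z)\xrightarrow{\partial^0}H^1(X,Y)\to H^1(X,Z)\to\cdots$$ is exact. Let $U_\partial$, with values in the abelian $R$-linear category $\mathcal A_\partial(\mathcal C)$, be the universal relative cohomology, and for a relative cohomology $H$ with values in $\mathcal B$ let $F_H^\partial:\mathcal A_\partial(\mathcal C)\to\mathcal B$ be the exact $R$-linear functor, unique up to isomorphism, with $(F^\partial_H)_*U_\partial\cong H$. A *set of axioms* $\dagger$ consists of a set of morphisms of $\mathcal A(\mathcal C)$ (to be made invertible) and a set of pairs of parallel morphisms of $\mathcal A(\mathcal C)$ (to be made equal: commutativity of diagrams). A $\dagger$-*cohomology* is a cohomology $H$ with values in some abelian $R$-linear category such that $F_H$ sends the former to isomorphisms and identifies the two members of each of the latter. Let $\mathcal I^\dagger\subseteq\mathcal A(\mathcal C)$ be the smallest Serre subcategory containing the kernels and cokernels of the morphisms to be inverted and of the equalisers $\mathrm{Eq}(f,g)\to X$ of the pairs $f,g:X\to Y$ to be identified, and let $\mathcal A^\dagger(\mathcal C):=\mathcal A(\mathcal C)/\mathcal I^\dagger$ be the Serre quotient. For a class $\mathcal S$ of cohomologies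 let $\mathcal I_{\mathcal S}:=\bigcap_{H\in\mathcal S}\operatorname{Ker}F_H$ and $\mathcal A_{\mathcal S}(\mathcal C):=\mathcal A(\mathcal C)/\mathcal I_{\mathcal S}$. Define in the same way, with $\mathcal A_\partial(\mathcal C)$ and $F_H^\partial$ in place of $\mathcal A(\mathcal C)$ and $F_H$, sets of axioms $\dagger$ in the relative case, relative $\dagger$-cohomologies, $\mathcal I^\dagger_\partial$, $\mathcal A^\dagger_\partial(\mathcal C):=\mathcal A_\partial(\mathcal C)/\mathcal I^\dagger_\partial$, and, for a class $\mathcal S$ of relative cohomologies, $\mathcal I_{\partial,\mathcal S}$ and $\mathcal A_{\partial,\mathcal S}(\mathcal C)$. **Proposition.** If $\mathcal S$ is the class of all $\dagger$-cohomologies on $\mathcal C$, for a set $\dagger$ of axioms, then $\mathcal I^\dagger=\mathcal I_{\mathcal S}$; therefore $\mathcal A^\dagger(\mathcal C)=\mathcal A_{\mathcal S}(\mathcal C)$, i.e. there is an $R$-linear equivalence between these categories compatible with the projections from $\mathcal A(\mathcal C)$. Similarly, if $\mathcal S$ is the class of all relative $\dagger$-cohomologies, for a set $\dagger$ of axioms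 in the relative case, then $\mathcal I^\dagger_\partial=\mathcal I_{\partial,\mathcal S}$ and $\mathcal A^\dagger_\partial(\mathcal C)=\mathcal A_{\partial,\mathcal S}(\mathcal C)$ in the same sense. -/

import Mathlib

open CategoryTheory Category Limits Preadditive Opposite

set_option linter.unusedSectionVars false
set_option linter.checkUnivs false

noncomputable section

namespace UniversalCohomology

universe w v u v' u' v'' u'' t s

/-- The objects of Adelman's free abelian category on an `R`-linear additive category `V`:
sequences `src ⟶ mid ⟶ tgt` in `V` (the composition need not vanish). Such a sequence stands for
the image of the morphism from the kernel of `mid ⟶ tgt` to the cokernel of `src ⟶ mid`. -/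
structure Adelman (R : Type w) (V : Type u) [Category.{v} V] where
  {src : V}
  {mid : V}
  {tgt : V}
  p : src ⟶ mid
  q : mid ⟶ tgt

namespace Adelman

section Basic

variable {R : Type w} [CommRing R] {V : Type u} [Category.{v} V] [Preadditive V] [Linear R V]

/-- The morphisms `X.mid ⟶ Y.mid` that extend to a morphism of sequences. -/
def good (X Y : Adelman R V) : Submodule R (X.mid ⟶ Y.mid) where
  carrier := {f | (∃ l, X.p ≫ f = l ≫ Y.p) ∧ ∃ r, f ≫ Y.q = X.q ≫ r}
  add_mem' := by
    rintro f g ⟨⟨l, hl⟩, r, hr⟩ ⟨⟨l', hl'⟩, r', hr'⟩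
    exact ⟨⟨l + l', by simp [hl, hl']⟩, r + r', by simp [hr, hr']⟩
  zero_mem' := ⟨⟨0, by simp⟩, 0, by simp⟩
  smul_mem' := by
    rintro a f ⟨⟨l, hl⟩, r, hr⟩
    exact ⟨⟨a • l, by simp [hl]⟩, a • r, by simp [hr]⟩

lemma mem_good {X Y : Adelman R V} {f : X.mid ⟶ Y.mid} (l : X.src ⟶ Y.src) (r : X.tgt ⟶ Y.tgt)
    (hl : X.p ≫ f = l ≫ Y.p) (hr : f ≫ Y.q = X.q ≫ r) : f ∈ good X Y := ⟨⟨l, hl⟩, r, hr⟩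

lemma mem_good_iff {X Y : Adelman R V} (f : X.mid ⟶ Y.mid) :
    f ∈ good X Y ↔ (∃ l, X.p ≫ f = l ≫ Y.p) ∧ ∃ r, f ≫ Y.q = X.q ≫ r := Iff.rfl

/-- The morphisms of sequences which are identified with zero. -/
def null (X Y : Adelman R V) : Submodule R (X.mid ⟶ Y.mid) where
  carrier := {f | ∃ s t, f = s ≫ Y.p + X.q ≫ t}
  add_mem' := by
    rintro f g ⟨s, t, rfl⟩ ⟨s', t', rfl⟩
    exact ⟨s + s', t + t', by simp only [add_comp, comp_add]; abel⟩
  zero_mem' := ⟨0, 0, by simp⟩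
  smul_mem' := by
    rintro a f ⟨s, t, rfl⟩
    exact ⟨a • s, a • t, by simp⟩

/-- Morphisms in the free abelian category: morphisms of sequences up to the null ones. -/
def Hom (X Y : Adelman R V) : Type v := good X Y ⧸ (null X Y).submoduleOf (good X Y)

instance (X Y : Adelman R V) : AddCommGroup (Hom X Y) :=
  inferInstanceAs (AddCommGroup (good X Y ⧸ (null X Y).submoduleOf (good X Y)))

instance (X Y : Adelman R V) : Module R (Hom X Y) :=
  inferInstanceAs (Module R (good X Y ⧸ (null X Y).submoduleOf (good X Y)))

def Hom.mk {X Y : Adelman R V} (f : good X Y) : Hom X Y :=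
  (Submodule.mkQ ((null X Y).submoduleOf (good X Y))) f

lemma Hom.mk_surjective {X Y : Adelman R V} (φ : Hom X Y) : ∃ f, φ = Hom.mk f := by
  obtain ⟨f, rfl⟩ := Submodule.mkQ_surjective _ φ
  exact ⟨f, rfl⟩

lemma id_mem (X : Adelman R V) : 𝟙 X.mid ∈ good X X := ⟨⟨𝟙 _, by simp⟩, 𝟙 _, by simp⟩

lemma comp_mem {X Y Z : Adelman R V} {f : X.mid ⟶ Y.mid} {g : Y.mid ⟶ Z.mid}
    (hf : f ∈ good X Y) (hg : g ∈ good Y Z) : f ≫ g ∈ good X Z := by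
  obtain ⟨⟨l, hl⟩, r, hr⟩ := hf
  obtain ⟨⟨l', hl'⟩, r', hr'⟩ := hg
  exact ⟨⟨l ≫ l', by simp [reassoc_of% hl, hl']⟩, r ≫ r', by simp [reassoc_of% hr, hr']⟩

def Hom.comp {X Y Z : Adelman R V} : Hom X Y → Hom Y Z → Hom X Z :=
  Quotient.map₂ (fun f g ↦ ⟨f.1 ≫ g.1, comp_mem f.2 g.2⟩) (by
    intro f f' hf g g' hg
    obtain ⟨s, t, h⟩ := (Submodule.quotientRel_def _).1 hf
    obtain ⟨s', t', h'⟩ := (Submodule.quotientRel_def _).1 hg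
    refine (Submodule.quotientRel_def _).2 ?_
    obtain ⟨f, ⟨l, hl⟩, r, hr⟩ := f
    obtain ⟨g', ⟨l', hl'⟩, r', hr'⟩ := g'
    refine ⟨f ≫ s' + s ≫ l', t ≫ g' + r ≫ t', ?_⟩
    simp only [Submodule.subtype_apply, AddSubgroupClass.coe_sub] at h h' ⊢
    have : f ≫ g.1 - f'.1 ≫ g' = f ≫ (g.1 - g') + (f - f'.1) ≫ g' := by
      simp only [comp_sub, sub_comp]; abel
    rw [this, h, h']
    simp only [comp_add, add_comp, assoc, hl', reassoc_of% hr]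
    abel)

instance : Category (Adelman R V) where
  Hom := Hom
  id X := Hom.mk ⟨𝟙 X.mid, id_mem X⟩
  comp := Hom.comp
  id_comp φ := by
    obtain ⟨f, rfl⟩ := Hom.mk_surjective φ
    exact congrArg Hom.mk (Subtype.ext (id_comp f.1))
  comp_id φ := by
    obtain ⟨f, rfl⟩ := Hom.mk_surjective φ
    exact congrArg Hom.mk (Subtype.ext (comp_id f.1))
  assoc φ χ ψ := by
    obtain ⟨f, rfl⟩ := Hom.mk_surjective φ
    obtain ⟨g, rfl⟩ := Hom.mk_surjective χ
    obtain ⟨h, rfl⟩ := Hom.mk_surjective ψ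
    exact congrArg Hom.mk (Subtype.ext (assoc f.1 g.1 h.1))

instance : Preadditive (Adelman R V) where
  homGroup X Y := inferInstanceAs (AddCommGroup (Hom X Y))
  add_comp X Y Z φ χ ψ := by
    obtain ⟨f, rfl⟩ := Hom.mk_surjective φ
    obtain ⟨g, rfl⟩ := Hom.mk_surjective χ
    obtain ⟨h, rfl⟩ := Hom.mk_surjective ψ
    exact congrArg Hom.mk (Subtype.ext (add_comp _ _ _ f.1 g.1 h.1))
  comp_add X Y Z φ χ ψ := by
    obtain ⟨f, rfl⟩ := Hom.mk_surjective φ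
    obtain ⟨g, rfl⟩ := Hom.mk_surjective χ
    obtain ⟨h, rfl⟩ := Hom.mk_surjective ψ
    exact congrArg Hom.mk (Subtype.ext (comp_add _ _ _ f.1 g.1 h.1))

instance : Linear R (Adelman R V) where
  homModule X Y := inferInstanceAs (Module R (Hom X Y))
  smul_comp X Y Z a φ χ := by
    obtain ⟨f, rfl⟩ := Hom.mk_surjective φ
    obtain ⟨g, rfl⟩ := Hom.mk_surjective χ
    exact congrArg Hom.mk (Subtype.ext (Linear.smul_comp _ _ _ a f.1 g.1))
  comp_smul X Y Z φ a χ := by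
    obtain ⟨f, rfl⟩ := Hom.mk_surjective φ
    obtain ⟨g, rfl⟩ := Hom.mk_surjective χ
    exact congrArg Hom.mk (Subtype.ext (Linear.comp_smul _ _ _ f.1 a g.1))

def homMk {X Y : Adelman R V} (f : X.mid ⟶ Y.mid) (h : f ∈ good X Y) : X ⟶ Y := Hom.mk ⟨f, h⟩

lemma exists_homMk {X Y : Adelman R V} (φ : X ⟶ Y) : ∃ f h, φ = homMk f h := by
  obtain ⟨f, rfl⟩ := Hom.mk_surjective φ
  exact ⟨f.1, f.2, rfl⟩

lemma homMk_comp {X Y Z : Adelman R V} (f : X.mid ⟶ Y.mid) (h) (g : Y.mid ⟶ Z.mid) (h') :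
    homMk f h ≫ homMk g h' = homMk (f ≫ g) (comp_mem h h') := rfl

lemma homMk_id (X : Adelman R V) : 𝟙 X = homMk (𝟙 X.mid) (id_mem X) := rfl

lemma homMk_add {X Y : Adelman R V} (f g : X.mid ⟶ Y.mid) (h h') :
    homMk f h + homMk g h' = (homMk (f + g) ((good X Y).add_mem h h') : X ⟶ Y) := rfl

lemma homMk_smul {X Y : Adelman R V} (a : R) (f : X.mid ⟶ Y.mid) (h) :
    a • homMk f h = (homMk (a • f) ((good X Y).smul_mem a h) : X ⟶ Y) := rfl

lemma homMk_congr {X Y : Adelman R V} {f g : X.mid ⟶ Y.mid} (e : f = g) (h h') :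
    (homMk f h : X ⟶ Y) = homMk g h' := by subst e; rfl

lemma homMk_eq_iff {X Y : Adelman R V} (f g : X.mid ⟶ Y.mid) (h h') :
    (homMk f h : X ⟶ Y) = homMk g h' ↔ ∃ s t, f - g = s ≫ Y.p + X.q ≫ t :=
  Submodule.Quotient.eq _

lemma homMk_eq_zero_iff {X Y : Adelman R V} (f : X.mid ⟶ Y.mid) (h) :
    (homMk f h : X ⟶ Y) = 0 ↔ ∃ s t, f = s ≫ Y.p + X.q ≫ t := by
  have : (0 : X ⟶ Y) = homMk 0 (good X Y).zero_mem := rfl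
  rw [this, homMk_eq_iff, sub_zero]

end Basic

section AbelianStr

variable {R : Type w} [CommRing R] {V : Type u} [Category.{v} V] [Preadditive V] [Linear R V]
  [HasBinaryBiproducts V]

/-- The kernel of a morphism in the free abelian category. -/
abbrev kerObj {X Y : Adelman R V} (f : X.mid ⟶ Y.mid) : Adelman R V where
  p := biprod.map X.p (𝟙 Y.src)
  q := biprod.fst ≫ X.q ≫ biprod.inl + (biprod.fst ≫ f - biprod.snd ≫ Y.p) ≫ biprod.inr

/-- The cokernel of a morphism in the free abelian category. -/
abbrev cokerObj {X Y : Adelman R V} (f : X.mid ⟶ Y.mid) : Adelman R V where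
  p := biprod.fst ≫ Y.p ≫ biprod.inl + biprod.snd ≫ (f ≫ biprod.inl + X.q ≫ biprod.inr)
  q := biprod.map Y.q (𝟙 X.tgt)

section
variable {X Y : Adelman R V} (f : X.mid ⟶ Y.mid)

def kerι : kerObj f ⟶ X :=
  homMk biprod.fst (mem_good biprod.fst biprod.fst (by simp) (by simp))

def cokerπ : Y ⟶ cokerObj f :=
  homMk biprod.inl (mem_good biprod.inl biprod.inl (by simp) (by simp))

variable (hf : f ∈ good X Y)

lemma kerι_comp : kerι f ≫ homMk f hf = 0 := by
  rw [kerι, homMk_comp, homMk_eq_zero_iff]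
  exact ⟨biprod.snd, biprod.snd, by simp⟩

lemma comp_cokerπ : homMk f hf ≫ cokerπ f = 0 := by
  rw [cokerπ, homMk_comp, homMk_eq_zero_iff]
  exact ⟨biprod.inr, -biprod.inr, by simp⟩

instance : Mono (kerι f) := by
  rw [Preadditive.mono_iff_cancel_zero]
  intro Z φ hφ
  obtain ⟨g, _, rfl⟩ := exists_homMk φ
  rw [kerι, homMk_comp, homMk_eq_zero_iff] at hφ
  obtain ⟨s, t, h⟩ := hφ
  rw [homMk_eq_zero_iff]
  refine ⟨biprod.lift s (g ≫ biprod.snd), biprod.lift t 0, ?_⟩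
  ext <;> simp [h]

instance : Epi (cokerπ f) := by
  rw [Preadditive.epi_iff_cancel_zero]
  intro Z φ hφ
  obtain ⟨g, _, rfl⟩ := exists_homMk φ
  rw [cokerπ, homMk_comp, homMk_eq_zero_iff] at hφ
  obtain ⟨s, t, h⟩ := hφ
  rw [homMk_eq_zero_iff]
  refine ⟨biprod.desc s 0, biprod.desc t (biprod.inr ≫ g), ?_⟩
  ext <;> simp [h]

lemma ker_lift {Z : Adelman R V} (φ : Z ⟶ X) (h : φ ≫ homMk f hf = 0) :
    ∃ l, l ≫ kerι f = φ := by
  obtain ⟨g, hg, rfl⟩ := exists_homMk φ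
  obtain ⟨⟨l, hl⟩, r, hr⟩ := (mem_good_iff g).1 hg
  rw [homMk_comp, homMk_eq_zero_iff] at h
  obtain ⟨s, t, h⟩ := h
  refine ⟨homMk (biprod.lift g s)
    (mem_good (biprod.lift l (Z.p ≫ s)) (biprod.lift r t) ?_ ?_), ?_⟩
  · ext <;> simp [hl]
  · ext <;> simp [hr, h]
  · rw [kerι, homMk_comp]
    exact homMk_congr (by simp) _ _

lemma coker_desc {Z : Adelman R V} (φ : Y ⟶ Z) (h : homMk f hf ≫ φ = 0) :
    ∃ l, cokerπ f ≫ l = φ := by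
  obtain ⟨g, hg, rfl⟩ := exists_homMk φ
  obtain ⟨⟨l, hl⟩, r, hr⟩ := (mem_good_iff g).1 hg
  rw [homMk_comp, homMk_eq_zero_iff] at h
  obtain ⟨s, t, h⟩ := h
  refine ⟨homMk (biprod.desc g (-t))
    (mem_good (biprod.desc l s) (biprod.desc r (-(t ≫ Z.q))) ?_ ?_), ?_⟩
  · ext <;> simp [hl, h]
  · ext <;> simp [hr]
  · rw [cokerπ, homMk_comp]
    exact homMk_congr (by simp) _ _

def kerIsLimit : IsLimit (KernelFork.ofι _ (kerι_comp f hf)) :=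
  KernelFork.IsLimit.ofι' _ (kerι_comp f hf) (fun g hg ↦
    ⟨_, (ker_lift f hf g hg).choose_spec⟩)

def cokerIsColimit : IsColimit (CokernelCofork.ofπ _ (comp_cokerπ f hf)) :=
  CokernelCofork.IsColimit.ofπ' _ (comp_cokerπ f hf) (fun g hg ↦
    ⟨_, (coker_desc f hf g hg).choose_spec⟩)

lemma mono_lift [Mono (homMk f hf : X ⟶ Y)] {Z : Adelman R V} (φ : Z ⟶ Y)
    (h : φ ≫ cokerπ f = 0) : ∃ l : Z ⟶ X, l ≫ homMk f hf = φ := by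
  have h0 : kerι f = 0 := by
    rw [← cancel_mono (homMk f hf : X ⟶ Y), kerι_comp, zero_comp]
  rw [kerι, homMk_eq_zero_iff] at h0
  obtain ⟨s, t, e⟩ := h0
  have e₁ : 𝟙 X.mid = (biprod.inl ≫ s) ≫ X.p + X.q ≫ biprod.inl ≫ t +
      f ≫ biprod.inr ≫ t := by
    simpa [add_assoc] using biprod.inl ≫= e
  have e₂ : Y.p ≫ biprod.inr ≫ t = (biprod.inr ≫ s) ≫ X.p := by
    have := biprod.inr ≫= e
    simp only [comp_add, biprod.inr_fst, biprod.inr_fst_assoc, biprod.inr_snd_assoc, sub_comp,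
      comp_sub, add_comp, assoc, zero_comp] at this
    simp only [assoc]
    grind
  generalize biprod.inl ≫ s = s₁ at *
  generalize biprod.inr ≫ s = s₂ at *
  generalize biprod.inl ≫ t = t₁ at *
  generalize biprod.inr ≫ t = t₂ at *
  obtain ⟨g, hg, rfl⟩ := exists_homMk φ
  obtain ⟨⟨l, hl⟩, r, hr⟩ := (mem_good_iff g).1 hg
  rw [cokerπ, homMk_comp, homMk_eq_zero_iff] at h
  obtain ⟨a, b, h⟩ := h
  have h₁ : g = (a ≫ biprod.fst) ≫ Y.p + (a ≫ biprod.snd) ≫ f + Z.q ≫ b ≫ biprod.fst := by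
    simpa [add_assoc] using h =≫ biprod.fst
  have h₂ : 0 = (a ≫ biprod.snd) ≫ X.q + Z.q ≫ b ≫ biprod.snd := by
    simpa [add_assoc] using h =≫ biprod.snd
  generalize a ≫ biprod.fst = a₁ at *
  generalize a ≫ biprod.snd = a₂ at *
  generalize b ≫ biprod.fst = b₁ at *
  generalize b ≫ biprod.snd = b₂ at *
  have u := Z.p ≫= h₁ =≫ t₂
  have v := Z.p ≫= h₂ =≫ t₁
  have w := Z.p ≫= a₂ ≫= e₁
  have x := l ≫= e₂
  have y := Z.p ≫= a₁ ≫= e₂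
  simp only [add_comp, comp_add, assoc, zero_comp, comp_zero, comp_id, reassoc_of% hl] at u v w x y
  refine ⟨homMk (a₂ + Z.q ≫ (b₂ ≫ t₁ + b₁ ≫ t₂)) (mem_good (l ≫ s₂ + Z.p ≫ a₂ ≫ s₁ - Z.p ≫ a₁ ≫ s₂)
    (-b₂ + (b₂ ≫ t₁ + b₁ ≫ t₂) ≫ X.q) ?_ ?_), ?_⟩
  · simp only [add_comp, comp_add, sub_comp, assoc]
    grind
  · simp only [add_comp, comp_add, comp_neg, assoc]
    grind
  · rw [homMk_comp, homMk_eq_iff]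
    refine ⟨-a₁, -b₁ + (b₂ ≫ t₁ + b₁ ≫ t₂) ≫ f, ?_⟩
    simp only [add_comp, comp_add, neg_comp, comp_neg, assoc]
    grind

lemma epi_desc [Epi (homMk f hf : X ⟶ Y)] {Z : Adelman R V} (φ : X ⟶ Z)
    (h : kerι f ≫ φ = 0) : ∃ l : Y ⟶ Z, homMk f hf ≫ l = φ := by
  have h0 : cokerπ f = 0 := by
    rw [← cancel_epi (homMk f hf : X ⟶ Y), comp_cokerπ, comp_zero]
  rw [cokerπ, homMk_eq_zero_iff] at h0
  obtain ⟨s, t, e⟩ := h0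
  have e₁ : 𝟙 Y.mid = (s ≫ biprod.fst) ≫ Y.p + (s ≫ biprod.snd) ≫ f +
      Y.q ≫ t ≫ biprod.fst := by
    simpa [add_assoc] using e =≫ biprod.fst
  have e₂ : 0 = (s ≫ biprod.snd) ≫ X.q + Y.q ≫ t ≫ biprod.snd := by
    simpa [add_assoc] using e =≫ biprod.snd
  generalize s ≫ biprod.fst = s₁ at *
  generalize s ≫ biprod.snd = s₂ at *
  generalize t ≫ biprod.fst = t₁ at *
  generalize t ≫ biprod.snd = t₂ at *
  obtain ⟨g, hg, rfl⟩ := exists_homMk φ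
  obtain ⟨⟨l, hl⟩, r, hr⟩ := (mem_good_iff g).1 hg
  rw [kerι, homMk_comp, homMk_eq_zero_iff] at h
  obtain ⟨a, b, h⟩ := h
  have h₁ : g = (biprod.inl ≫ a) ≫ Z.p + X.q ≫ biprod.inl ≫ b + f ≫ biprod.inr ≫ b := by
    simpa [add_assoc] using biprod.inl ≫= h
  have h₂ : 0 = (biprod.inr ≫ a) ≫ Z.p - Y.p ≫ biprod.inr ≫ b := by
    simpa [add_assoc, sub_eq_add_neg] using biprod.inr ≫= h
  generalize biprod.inl ≫ a = a₁ at *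
  generalize biprod.inr ≫ a = a₂ at *
  generalize biprod.inl ≫ b = b₁ at *
  generalize biprod.inr ≫ b = b₂ at *
  have u := s₂ ≫= h₁ =≫ Z.q
  have v := (e₂ =≫ b₁) =≫ Z.q
  have w := (e₁ =≫ b₂) =≫ Z.q
  have x := e₂ =≫ r
  have y := s₁ ≫= h₂ =≫ Z.q
  simp only [add_comp, comp_add, sub_comp, comp_sub, assoc, zero_comp, comp_zero, id_comp, hr]
    at u v w x y
  refine ⟨homMk (b₂ + (s₂ ≫ a₁ - s₁ ≫ a₂) ≫ Z.p) (mem_good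
    (a₂ + Y.p ≫ (s₂ ≫ a₁ - s₁ ≫ a₂)) (t₁ ≫ b₂ ≫ Z.q - t₂ ≫ r + t₂ ≫ b₁ ≫ Z.q) ?_ ?_), ?_⟩
  · simp only [add_comp, comp_add, sub_comp, comp_sub, assoc]
    grind
  · simp only [add_comp, comp_add, comp_sub, sub_comp, assoc]
    grind
  · rw [homMk_comp, homMk_eq_iff]
    refine ⟨-a₁ + f ≫ (s₂ ≫ a₁ - s₁ ≫ a₂), -b₁, ?_⟩
    simp only [add_comp, comp_add, neg_comp, comp_neg, comp_sub, sub_comp, assoc]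
    grind
end

instance : HasKernels (Adelman R V) where
  has_limit φ := by
    obtain ⟨f, hf, rfl⟩ := exists_homMk φ
    exact ⟨_, kerIsLimit f hf⟩

instance : HasCokernels (Adelman R V) where
  has_colimit φ := by
    obtain ⟨f, hf, rfl⟩ := exists_homMk φ
    exact ⟨_, cokerIsColimit f hf⟩

instance : IsNormalMonoCategory (Adelman R V) where
  normalMonoOfMono φ _ := by
    obtain ⟨f, hf, rfl⟩ := exists_homMk φ
    exact ⟨⟨_, cokerπ f, comp_cokerπ f hf, KernelFork.IsLimit.ofι' _ _ (fun g hg ↦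
      ⟨_, (mono_lift f hf g hg).choose_spec⟩)⟩⟩

instance : IsNormalEpiCategory (Adelman R V) where
  normalEpiOfEpi φ _ := by
    obtain ⟨f, hf, rfl⟩ := exists_homMk φ
    exact ⟨⟨_, kerι f, kerι_comp f hf, CokernelCofork.IsColimit.ofπ' _ _ (fun g hg ↦
      ⟨_, (epi_desc f hf g hg).choose_spec⟩)⟩⟩

instance : HasBinaryBiproducts (Adelman R V) where
  has_binary_biproduct X Y := hasBinaryBiproduct_of_total
    { pt := ⟨biprod.map X.p Y.p, biprod.map X.q Y.q⟩
      fst := homMk biprod.fst (mem_good biprod.fst biprod.fst (by simp) (by simp))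
      snd := homMk biprod.snd (mem_good biprod.snd biprod.snd (by simp) (by simp))
      inl := homMk biprod.inl (mem_good biprod.inl biprod.inl (by simp) (by simp))
      inr := homMk biprod.inr (mem_good biprod.inr biprod.inr (by simp) (by simp))
      inl_fst := homMk_congr biprod.inl_fst _ _
      inl_snd := homMk_congr biprod.inl_snd _ (good X Y).zero_mem
      inr_fst := homMk_congr biprod.inr_fst _ (good Y X).zero_mem
      inr_snd := homMk_congr biprod.inr_snd _ _ }
    (homMk_congr biprod.total _ _)

open ZeroObject in
instance [HasZeroObject V] : HasZeroObject (Adelman R V) := by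
  refine ⟨⟨(0 : (0 : V) ⟶ 0), (0 : (0 : V) ⟶ 0)⟩, (IsZero.iff_id_eq_zero _).2 ?_⟩
  exact homMk_congr ((isZero_zero V).eq_of_src _ _) _ (zero_mem _)

instance [HasZeroObject V] : Abelian (Adelman R V) where
  has_finite_products := hasFiniteProducts_of_has_binary_and_terminal

end AbelianStr

end Adelman

namespace Adelman

section Extension

variable {R : Type w} [CommRing R] {V : Type u} [Category.{v} V] [Preadditive V] [Linear R V]
  {B : Type u'} [Category.{v'} B] [Abelian B] (L : V ⥤ B) [L.Additive]

/-- The value on `X` of the exact extension of `L : V ⥤ B` to the free abelian category: the image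
of `ker (L X.q) ⟶ coker (L X.p)`. -/
def extObj (X : Adelman R V) : B :=
  Abelian.image (kernel.ι (L.map X.q) ≫ cokernel.π (L.map X.p))

def extE (X : Adelman R V) : kernel (L.map X.q) ⟶ extObj L X :=
  Abelian.factorThruImage (kernel.ι (L.map X.q) ≫ cokernel.π (L.map X.p))

def extI (X : Adelman R V) : extObj L X ⟶ cokernel (L.map X.p) :=
  Abelian.image.ι (kernel.ι (L.map X.q) ≫ cokernel.π (L.map X.p))

instance (X : Adelman R V) : Epi (extE L X) :=
  inferInstanceAs (Epi (Abelian.factorThruImage (kernel.ι (L.map X.q) ≫ cokernel.π (L.map X.p))))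

instance (X : Adelman R V) : Mono (extI L X) :=
  inferInstanceAs (Mono (Abelian.image.ι (kernel.ι (L.map X.q) ≫ cokernel.π (L.map X.p))))

lemma extE_extI (X : Adelman R V) :
    extE L X ≫ extI L X = kernel.ι (L.map X.q) ≫ cokernel.π (L.map X.p) :=
  Abelian.image.fac _

lemma extI_desc_condition {X Y : Adelman R V} (f : X.mid ⟶ Y.mid) (hf : f ∈ good X Y) :
    ∃ m : extObj L X ⟶ extObj L Y, extE L X ≫ m ≫ extI L Y =
      kernel.ι (L.map X.q) ≫ L.map f ≫ cokernel.π (L.map Y.p) := by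
  obtain ⟨⟨l, hl⟩, r, hr⟩ := (mem_good_iff f).1 hf
  have e₁ : (kernel.ι (L.map X.q) ≫ L.map f) ≫ L.map Y.q = 0 := by
    rw [assoc, ← L.map_comp, hr, L.map_comp, kernel.condition_assoc, zero_comp]
  have e₂ : L.map X.p ≫ L.map f ≫ cokernel.π (L.map Y.p) = 0 := by
    rw [← L.map_comp_assoc, hl, L.map_comp, assoc, cokernel.condition, comp_zero]
  have e₃ : (extI L X ≫ cokernel.desc _ _ e₂) ≫ cokernel.π (kernel.ι (L.map Y.q) ≫
      cokernel.π (L.map Y.p)) = 0 := by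
    rw [← cancel_epi (extE L X), ← assoc, ← assoc, extE_extI, assoc _ _ (cokernel.desc _ _ _),
      cokernel.π_desc, comp_zero]
    have h := kernel.lift _ _ e₁ ≫= cokernel.condition (kernel.ι (L.map Y.q) ≫
      cokernel.π (L.map Y.p))
    rw [comp_zero] at h
    simpa only [assoc, kernel.lift_ι_assoc] using h
  obtain ⟨m, e₄⟩ : ∃ m : extObj L X ⟶ extObj L Y, m ≫ extI L Y = extI L X ≫ cokernel.desc _ _ e₂ :=
    ⟨kernel.lift _ _ e₃, kernel.lift_ι _ _ _⟩
  exact ⟨m, by rw [e₄, ← assoc, extE_extI, assoc, cokernel.π_desc]⟩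

lemma exists_extMap {X Y : Adelman R V} (φ : X ⟶ Y) :
    ∃ m : extObj L X ⟶ extObj L Y, ∀ f h, φ = homMk f h →
      extE L X ≫ m ≫ extI L Y = kernel.ι (L.map X.q) ≫ L.map f ≫ cokernel.π (L.map Y.p) := by
  obtain ⟨f, hf, rfl⟩ := exists_homMk φ
  obtain ⟨m, hm⟩ := extI_desc_condition L f hf
  refine ⟨m, ?_⟩
  intro f' h' e
  rw [homMk_eq_iff] at e
  obtain ⟨s, t, e⟩ := e
  rw [hm, ← sub_eq_zero, ← comp_sub, ← sub_comp, ← L.map_sub, e]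
  simp

def extMap {X Y : Adelman R V} (φ : X ⟶ Y) : extObj L X ⟶ extObj L Y := (exists_extMap L φ).choose

lemma extMap_homMk {X Y : Adelman R V} (f : X.mid ⟶ Y.mid) (h) :
    extE L X ≫ extMap L (homMk f h : X ⟶ Y) ≫ extI L Y =
      kernel.ι (L.map X.q) ≫ L.map f ≫ cokernel.π (L.map Y.p) :=
  (exists_extMap L (homMk f h : X ⟶ Y)).choose_spec _ _ rfl

lemma ext_hom_ext {X Y : Adelman R V} {m m' : extObj L X ⟶ extObj L Y}
    (h : extE L X ≫ m ≫ extI L Y = extE L X ≫ m' ≫ extI L Y) : m = m' := by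
  rwa [cancel_epi, cancel_mono] at h

/-- The generalised element of the extension defined by a generalised element of the kernel. -/
def elt {X : Adelman R V} {A : B} (a : A ⟶ L.obj X.mid) (ha : a ≫ L.map X.q = 0) :
    A ⟶ extObj L X := kernel.lift _ a ha ≫ extE L X

lemma elt_extI {X : Adelman R V} {A : B} (a : A ⟶ L.obj X.mid) (ha : a ≫ L.map X.q = 0) :
    elt L a ha ≫ extI L X = a ≫ cokernel.π (L.map X.p) := by
  rw [elt, assoc, extE_extI, kernel.lift_ι_assoc]

lemma elt_congr {X : Adelman R V} {A : B} {a b : A ⟶ L.obj X.mid} (h : a = b)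
    (ha : a ≫ L.map X.q = 0) (hb : b ≫ L.map X.q = 0) : elt L a ha = elt L b hb := by
  subst h; rfl

lemma map_mem_ker {X Y : Adelman R V} {A : B} {a : A ⟶ L.obj X.mid} (ha : a ≫ L.map X.q = 0)
    {f : X.mid ⟶ Y.mid} (hf : f ∈ good X Y) : (a ≫ L.map f) ≫ L.map Y.q = 0 := by
  obtain ⟨⟨l, hl⟩, r, hr⟩ := (mem_good_iff f).1 hf
  rw [assoc, ← L.map_comp, hr, L.map_comp, ← assoc, ha, zero_comp]

lemma elt_map {X Y : Adelman R V} {A : B} (a : A ⟶ L.obj X.mid) (ha : a ≫ L.map X.q = 0)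
    (f : X.mid ⟶ Y.mid) (hf : f ∈ good X Y) :
    elt L a ha ≫ extMap L (homMk f hf) = elt L (a ≫ L.map f) (map_mem_ker L ha hf) := by
  rw [← cancel_mono (extI L Y), elt_extI, elt, assoc, assoc, extMap_homMk, kernel.lift_ι_assoc,
    assoc]

lemma extE_eq_elt (X : Adelman R V) : extE L X = elt L (kernel.ι (L.map X.q)) (by simp) := by
  rw [← cancel_mono (extI L X), elt_extI, extE_extI]

lemma extMap_id (X : Adelman R V) : extMap L (𝟙 X) = 𝟙 (extObj L X) := by
  apply ext_hom_ext
  rw [homMk_id, extMap_homMk, L.map_id, id_comp, id_comp, extE_extI]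

lemma extMap_comp {X Y Z : Adelman R V} (φ : X ⟶ Y) (χ : Y ⟶ Z) :
    extMap L (φ ≫ χ) = extMap L φ ≫ extMap L χ := by
  obtain ⟨f, hf, rfl⟩ := exists_homMk φ
  obtain ⟨g, hg, rfl⟩ := exists_homMk χ
  rw [← cancel_epi (extE L _), homMk_comp, extE_eq_elt, elt_map, ← assoc, elt_map, elt_map]
  exact elt_congr L (by simp) _ _

lemma extMap_add {X Y : Adelman R V} (φ χ : X ⟶ Y) :
    extMap L (φ + χ) = extMap L φ + extMap L χ := by
  obtain ⟨f, hf, rfl⟩ := exists_homMk φ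
  obtain ⟨g, hg, rfl⟩ := exists_homMk χ
  apply ext_hom_ext
  rw [homMk_add, extMap_homMk, add_comp, comp_add, extMap_homMk, extMap_homMk]
  simp

lemma extMap_smul [Linear R B] [L.Linear R] {X Y : Adelman R V} (φ : X ⟶ Y) (a : R) :
    extMap L (a • φ) = a • extMap L φ := by
  obtain ⟨f, hf, rfl⟩ := exists_homMk φ
  apply ext_hom_ext
  rw [homMk_smul, extMap_homMk, Linear.smul_comp, Linear.comp_smul, extMap_homMk]
  simp [L.map_smul]

/-- The exact extension of an additive functor to the free abelian category. -/
def ext : Adelman R V ⥤ B where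
  obj := extObj L
  map := extMap L
  map_id := extMap_id L
  map_comp := extMap_comp L

instance : (ext (R := R) L).Additive where
  map_add := extMap_add L _ _

instance ext_linear [Linear R B] [L.Linear R] : (ext (R := R) L).Linear R where
  map_smul := extMap_smul L

lemma exists_elt {X : Adelman R V} {A : B} (x : A ⟶ extObj L X) :
    ∃ (A' : B) (π : A' ⟶ A) (_ : Epi π) (a : A' ⟶ L.obj X.mid) (ha : a ≫ L.map X.q = 0),
      π ≫ x = elt L a ha := by
  obtain ⟨A', π, hπ, a, ha⟩ := surjective_up_to_refinements_of_epi (extE L X) x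
  refine ⟨A', π, hπ, a ≫ kernel.ι _, by simp, ?_⟩
  rw [ha, elt]
  congr 1
  rw [← cancel_mono (kernel.ι _), kernel.lift_ι]

lemma elt_eq_zero_iff {X : Adelman R V} {A : B} (a : A ⟶ L.obj X.mid) (ha : a ≫ L.map X.q = 0) :
    elt L a ha = 0 ↔ ∃ (A' : B) (π : A' ⟶ A) (_ : Epi π) (b : A' ⟶ L.obj X.src),
      π ≫ a = b ≫ L.map X.p := by
  rw [← cancel_mono (extI L X), elt_extI, zero_comp]
  exact CokernelCofork.IsColimit.comp_π_eq_zero_iff_up_to_refinements (cokernelIsCokernel _) a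

lemma comp_elt {X : Adelman R V} {A A' : B} (π : A' ⟶ A) (a : A ⟶ L.obj X.mid)
    (ha : a ≫ L.map X.q = 0) : π ≫ elt L a ha = elt L (π ≫ a) (by simp [ha]) := by
  rw [← cancel_mono (extI L X), assoc, elt_extI, elt_extI, assoc]

variable [HasBinaryBiproducts V]

section
variable {X Y : Adelman R V} (f : X.mid ⟶ Y.mid) (hf : f ∈ good X Y)

lemma L_total {x y : V} : L.map (biprod.fst : x ⊞ y ⟶ x) ≫ L.map biprod.inl +
    L.map biprod.snd ≫ L.map biprod.inr = 𝟙 (L.obj (x ⊞ y)) := by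
  rw [← L.map_comp, ← L.map_comp, ← L.map_add, biprod.total, L.map_id]

lemma mono_extMap : Mono (extMap L (kerι f)) := by
  rw [Preadditive.mono_iff_cancel_zero]
  intro A x hx
  obtain ⟨A', π, _, a, ha, e⟩ := exists_elt L x
  rw [← cancel_epi π, comp_zero, e]
  have h := π ≫= hx
  rw [← assoc, e, comp_zero, kerι] at h
  rw [elt_map, elt_eq_zero_iff] at h
  obtain ⟨A'', π', _, b, h⟩ := h
  rw [elt_eq_zero_iff]
  refine ⟨A'', π', inferInstance,
    b ≫ L.map biprod.inl + π' ≫ a ≫ L.map biprod.snd ≫ L.map biprod.inr, ?_⟩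
  have e₁ : biprod.inl ≫ (kerObj f).p = X.p ≫ biprod.inl := by simp
  have e₂ : biprod.inr ≫ (kerObj f).p = biprod.inr := by simp
  rw [add_comp, assoc, assoc, assoc, assoc, ← L.map_comp, ← L.map_comp, e₁, e₂, L.map_comp,
    ← assoc b, ← h, assoc, assoc, ← comp_add, ← comp_add, L_total, comp_id]

lemma exact_extMap_ker : (ShortComplex.mk (extMap L (kerι f)) (extMap L (homMk f hf))
    (by rw [← extMap_comp, kerι_comp]; exact (ext L).map_zero _ _)).Exact := by
  rw [ShortComplex.exact_iff_exact_up_to_refinements]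
  intro A x hx
  dsimp only at x hx
  obtain ⟨A', π, _, a, ha, e⟩ := exists_elt L x
  have h := π ≫= hx
  rw [← assoc, e, comp_zero] at h
  rw [elt_map, elt_eq_zero_iff] at h
  obtain ⟨A'', π', _, b, h⟩ := h
  have h' : (π' ≫ a ≫ L.map biprod.inl + b ≫ L.map biprod.inr) ≫ L.map (kerObj f).q = 0 := by
    have e₁ : biprod.inl ≫ (kerObj f).q = X.q ≫ biprod.inl + f ≫ biprod.inr := by simp
    have e₂ : biprod.inr ≫ (kerObj f).q = - Y.p ≫ biprod.inr := by simp
    rw [add_comp, assoc, assoc, assoc, ← L.map_comp, ← L.map_comp, e₁, e₂]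
    have h2 := π' ≫= ha =≫ L.map (biprod.inl : X.tgt ⟶ X.tgt ⊞ Y.mid)
    have h3 := h =≫ L.map (biprod.inr : Y.mid ⟶ X.tgt ⊞ Y.mid)
    simp only [assoc, zero_comp, comp_zero, L.map_add, L.map_neg, L.map_comp, comp_add, comp_neg] at h2 h3 ⊢
    rw [h2, h3]
    simp
  refine ⟨A'', π' ≫ π, inferInstance, elt L (X := kerObj f) _ h', ?_⟩
  dsimp only [kerι]
  rw [assoc, e, elt_map, comp_elt]
  refine elt_congr L ?_ _ _
  simp only [add_comp, assoc, ← L.map_comp]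
  simp

lemma epi_extMap : Epi (extMap L (cokerπ f)) := by
  rw [epi_iff_surjective_up_to_refinements]
  intro A y
  obtain ⟨A', π, _, c, hc, e⟩ := exists_elt L y
  have h₁ : c ≫ L.map biprod.snd = 0 := by
    have := hc =≫ L.map biprod.snd
    rw [assoc, ← L.map_comp] at this
    simpa using this
  have h₂ : (c ≫ L.map biprod.fst) ≫ L.map Y.q = 0 := by
    have := hc =≫ L.map biprod.fst
    rw [assoc, ← L.map_comp] at this
    simpa using this
  refine ⟨A', π, inferInstance, elt L _ h₂, ?_⟩
  dsimp only [cokerπ]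
  rw [e, elt_map]
  refine elt_congr L ?_ _ _
  have := c ≫= L_total L
  rw [comp_add, ← assoc, ← assoc, h₁, zero_comp, add_zero, comp_id] at this
  exact this.symm

lemma exact_extMap_coker : (ShortComplex.mk (extMap L (homMk f hf)) (extMap L (cokerπ f))
    (by rw [← extMap_comp, comp_cokerπ]; exact (ext L).map_zero _ _)).Exact := by
  rw [ShortComplex.exact_iff_exact_up_to_refinements]
  intro A y hy
  dsimp only at y hy
  obtain ⟨A', π, _, b, hb, e⟩ := exists_elt L y
  have h := π ≫= hy
  rw [← assoc, e, comp_zero, cokerπ] at h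
  rw [elt_map, elt_eq_zero_iff] at h
  obtain ⟨A'', π', _, d, h⟩ := h
  have h₁ : π' ≫ b = d ≫ L.map biprod.fst ≫ L.map Y.p + d ≫ L.map biprod.snd ≫ L.map f := by
    have := h =≫ L.map biprod.fst
    simp only [assoc, ← L.map_comp] at this
    simpa using this
  have h₂ : (d ≫ L.map biprod.snd) ≫ L.map X.q = 0 := by
    have := h =≫ L.map biprod.snd
    simp only [assoc, ← L.map_comp] at this
    simpa using this.symm
  refine ⟨A'', π' ≫ π, inferInstance, elt L _ h₂, ?_⟩
  dsimp only
  rw [assoc, e, elt_map, comp_elt, ← cancel_mono (extI L Y), elt_extI, elt_extI, h₁]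
  simp

instance ext_preservesFiniteLimits [HasZeroObject V] :
    PreservesFiniteLimits (ext (R := R) L) := by
  apply ((ext (R := R) L).preservesFiniteLimits_tfae.out 2 3).1
  intro X Y φ
  obtain ⟨f, hf, rfl⟩ := exists_homMk φ
  have : Mono (ShortComplex.mk (extMap L (kerι f)) (extMap L (homMk f hf))
    (by rw [← extMap_comp, kerι_comp]; exact (ext L).map_zero _ _)).f := mono_extMap L f
  exact preservesLimit_of_preserves_limit_cone (kerIsLimit f hf)
    ((KernelFork.isLimitMapConeEquiv _ _).2 (exact_extMap_ker L f hf).fIsKernel)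

instance ext_preservesFiniteColimits [HasZeroObject V] :
    PreservesFiniteColimits (ext (R := R) L) := by
  apply ((ext (R := R) L).preservesFiniteColimits_tfae.out 2 3).1
  intro X Y φ
  obtain ⟨f, hf, rfl⟩ := exists_homMk φ
  have : Epi (ShortComplex.mk (extMap L (homMk f hf)) (extMap L (cokerπ f))
    (by rw [← extMap_comp, comp_cokerπ]; exact (ext L).map_zero _ _)).g := epi_extMap L f
  exact preservesColimit_of_preserves_colimit_cocone (cokerIsColimit f hf)
    ((CokernelCofork.isColimitMapCoconeEquiv _ _).2 (exact_extMap_coker L f hf).gIsCokernel)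

end

variable (R) in
open ZeroObject in
abbrev embObj [HasZeroObject V] (x : V) : Adelman R V := ⟨(0 : 0 ⟶ x), (0 : x ⟶ 0)⟩

variable (R V) in
/-- The embedding of `V` in the free abelian category. -/
def embedding [HasZeroObject V] : V ⥤ Adelman R V where
  obj := embObj R
  map f := homMk f (mem_good 0 0 (by simp) (by simp))

instance [HasZeroObject V] : (embedding R V).Additive where

instance [HasZeroObject V] : (embedding R V).Linear R where

lemma embObj_ker [HasZeroObject V] (x : V) : 𝟙 (L.obj x) ≫ L.map (embObj R x).q = 0 := by simp

variable (R) in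
def embElt [HasZeroObject V] (x : V) : L.obj x ⟶ extObj L (embObj R x) :=
  elt L (X := embObj R x) (𝟙 (L.obj x)) (embObj_ker L x)

lemma comp_embElt [HasZeroObject V] (x : V) {A : B} (a : A ⟶ L.obj x) :
    a ≫ embElt R L x = elt L (X := embObj R x) a (by simp) := by
  rw [embElt]
  exact (comp_elt L (X := embObj R x) a _ _).trans (elt_congr L (by simp) _ _)

instance embElt_isIso [HasZeroObject V] (x : V) : IsIso (embElt R L x) := by
  have : Mono (embElt R L x) := by
    rw [Preadditive.mono_iff_cancel_zero]
    intro A a h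
    rw [comp_embElt, elt_eq_zero_iff] at h
    obtain ⟨A', π, _, b, h⟩ := h
    rw [← cancel_epi π]
    simpa using h
  have : Epi (embElt R L x) := by
    rw [epi_iff_surjective_up_to_refinements]
    intro A y
    obtain ⟨A', π, hπ, a, ha, h⟩ := exists_elt L y
    refine ⟨A', π, hπ, a, ?_⟩
    rw [h, comp_embElt]
  exact isIso_of_mono_of_epi _

/-- The exact extension restricts to the given functor. -/
def embeddingExtIso [HasZeroObject V] : embedding R V ⋙ ext L ≅ L :=
  Iso.symm (NatIso.ofComponents (fun x ↦ (@asIso _ _ _ _ (embElt R L x) (embElt_isIso L x) :)) (by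
    intro x y f
    refine Eq.trans (comp_embElt L y _) ?_
    refine Eq.trans ?_ (elt_map L (X := embObj R x) (Y := embObj R y) _ _ f _).symm
    exact elt_congr L (by simp) _ _))

end Extension

end Adelman

section Free

variable (R : Type w) [CommRing R] {D : Type u} [Category.{v} D]
  {B : Type u'} [Category.{v'} B] [Preadditive B] [Linear R B]

def coeff {X Y : D} (f : (Free.of R X : Free R D) ⟶ Free.of R Y) : (X ⟶ Y) →₀ R := f

def ofCoeff {X Y : D} (f : (X ⟶ Y) →₀ R) : (Free.of R X : Free R D) ⟶ Free.of R Y := f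

def freeEval (H : D ⥤ B) (X Y : D) : ((X ⟶ Y) →₀ R) →ₗ[R] (H.obj X ⟶ H.obj Y) :=
  Finsupp.linearCombination R (fun f : X ⟶ Y ↦ H.map f)

@[simp] lemma freeEval_single (H : D ⥤ B) (X Y : D) (f : X ⟶ Y) (r : R) :
    freeEval R H X Y (Finsupp.single f r) = r • H.map f := by
  simp [freeEval]

lemma freeEval_comp (H : D ⥤ B) {X Y Z : D} (f : (X ⟶ Y) →₀ R) (g : (Y ⟶ Z) →₀ R) :
    freeEval R H X Z (coeff R (ofCoeff R f ≫ ofCoeff R g)) =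
      freeEval R H X Y f ≫ freeEval R H Y Z g := by
  change freeEval R H X Z (f.sum fun f' s => g.sum fun g' t => Finsupp.single (f' ≫ g') (s * t)) = _
  simp only [Finsupp.sum, map_sum, freeEval_single]
  simp only [freeEval, Finsupp.linearCombination_apply, Finsupp.sum, sum_comp, comp_sum,
    Linear.smul_comp, Linear.comp_smul, mul_smul, H.map_comp]
  rw [Finset.sum_comm]
  refine Finset.sum_congr rfl fun y _ ↦ ?_
  rw [Finset.smul_sum]
  exact Finset.sum_congr rfl fun x _ ↦ smul_comm _ _ _

/-- The `R`-linear extension of a functor `D ⥤ B`. -/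
def freeLift (H : D ⥤ B) : Free R D ⥤ B where
  obj X := H.obj X
  map {X Y} f := freeEval R H X Y (coeff R f)
  map_id X := (freeEval_single R H X X (𝟙 (show D from X)) 1).trans ((one_smul R _).trans (H.map_id X))
  map_comp f g := freeEval_comp R H f g

instance (H : D ⥤ B) : (freeLift R H).Additive where
  map_add {X Y f g} := (freeEval R H X Y).map_add f g

instance (H : D ⥤ B) : (freeLift R H).Linear R where
  map_smul {X Y} f r := (freeEval R H X Y).map_smul r f

def freeEmbeddingLiftIso (H : D ⥤ B) : Free.embedding R D ⋙ freeLift R H ≅ H :=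
  NatIso.ofComponents (fun X ↦ Iso.refl (H.obj X)) (by
    intro X Y f
    refine (comp_id _).trans (((freeEval_single R H X Y f 1).trans ?_).trans (id_comp _).symm)
    simp)

end Free

section Mat

variable (R : Type w) [CommRing R] {V : Type u} [Category.{v} V] [Preadditive V] [Linear R V]
  {B : Type u'} [Category.{v'} B] [Preadditive B]

instance matModule (M N : Mat_ V) : Module R (M ⟶ N) :=
  inferInstanceAs (Module R (∀ i j, M.X i ⟶ N.X j))

lemma mat_smul_apply {M N : Mat_ V} (r : R) (f : M ⟶ N) (i j) : (r • f) i j = r • f i j := rfl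

instance matLinear : Linear R (Mat_ V) where
  homModule := matModule R
  smul_comp M N K r f g := by
    ext i k
    rw [mat_smul_apply, Mat_.comp_apply, Mat_.comp_apply, Finset.smul_sum]
    simp only [mat_smul_apply, Linear.smul_comp]
  comp_smul M N K f r g := by
    ext i k
    rw [mat_smul_apply, Mat_.comp_apply, Mat_.comp_apply, Finset.smul_sum]
    simp only [mat_smul_apply, Linear.comp_smul]

instance : HasBinaryBiproducts (Mat_ V) := hasBinaryBiproducts_of_finite_biproducts _

instance : HasZeroObject (Mat_ V) := inferInstance

variable [HasFiniteBiproducts B] (F : V ⥤ B) [F.Additive] [Linear R B] [F.Linear R]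

/-- The extension of an additive functor to finite tuples of objects and matrices. -/
def matLift : Mat_ V ⥤ B where
  obj M := ⨁ fun i => F.obj (M.X i)
  map f := biproduct.matrix fun i j => F.map (f i j)
  map_id X := by
    ext i j
    by_cases h : j = i
    · subst h; simp
    · simp [h]
  map_comp f g := by
    ext i j
    simp [biproduct.lift_desc]

instance : (matLift F).Additive where
  map_add {M N f g} := by
    change biproduct.matrix (fun i j => F.map ((f + g) i j)) =
      biproduct.matrix (fun i j => F.map (f i j)) + biproduct.matrix (fun i j => F.map (g i j))
    ext i j
    simp

instance : (matLift F).Linear R where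
  map_smul {M N} f r := by
    change biproduct.matrix (fun i j => F.map ((r • f) i j)) =
      r • biproduct.matrix (fun i j => F.map (f i j))
    ext i j
    simp [mat_smul_apply, F.map_smul]

def constIso (X : B) : (⨁ fun _ : PUnit.{1} => X) ≅ X where
  hom := biproduct.desc fun _ => 𝟙 X
  inv := biproduct.lift fun _ => 𝟙 X
  hom_inv_id := by
    ext
    simp
  inv_hom_id := by simp [biproduct.lift_desc]

def matEmbeddingLiftIso : Mat_.embedding V ⋙ matLift F ≅ F :=
  NatIso.ofComponents (fun X => constIso (F.obj X)) (by
    intro X Y f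
    change biproduct.matrix (fun _ _ : PUnit.{1} ↦ F.map f) ≫ biproduct.desc (fun _ => 𝟙 (F.obj Y)) =
      biproduct.desc (fun _ => 𝟙 (F.obj X)) ≫ F.map f
    ext
    simp [biproduct.lift_desc])

end Mat

section FreeAb

attribute [local instance] Abelian.hasFiniteBiproducts

variable (R : Type w) [CommRing R] (D : Type u) [Category.{v} D]

/-- The free abelian `R`-linear category on a category `D`: Adelman's category of the additive
`R`-linear category generated by `D` (finite tuples of objects of `D`, and matrices of formal
`R`-linear combinations of morphisms of `D`). -/
abbrev FreeAb : Type (max 1 u v w) := Adelman R (Mat_ (Free R D))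

/-- The universal functor from `D` to the free abelian `R`-linear category. -/
def FreeAb.unit : D ⥤ FreeAb R D :=
  Free.embedding R D ⋙ Mat_.embedding (Free R D) ⋙ Adelman.embedding R (Mat_ (Free R D))

variable {D} {B : Type u'} [Category.{v'} B] [Abelian B] [Linear R B] (H : D ⥤ B)

/-- The exact `R`-linear functor extending a functor `D ⥤ B`. -/
def FreeAb.ext : FreeAb R D ⥤ B := Adelman.ext (matLift (freeLift R H))

instance : (FreeAb.ext R H).Additive :=
  inferInstanceAs (Adelman.ext (R := R) (matLift (freeLift R H))).Additive

instance : (FreeAb.ext R H).Linear R :=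
  inferInstanceAs ((Adelman.ext (R := R) (matLift (freeLift R H))).Linear R)

instance : PreservesFiniteLimits (FreeAb.ext R H) :=
  inferInstanceAs (PreservesFiniteLimits (Adelman.ext (R := R) (matLift (freeLift R H))))

instance : PreservesFiniteColimits (FreeAb.ext R H) :=
  inferInstanceAs (PreservesFiniteColimits (Adelman.ext (R := R) (matLift (freeLift R H))))

/-- The extension restricts to the given functor. -/
def FreeAb.unitExtIso : FreeAb.unit R D ⋙ FreeAb.ext R H ≅ H :=
  Functor.associator _ _ _ ≪≫ Functor.isoWhiskerLeft _ (Functor.associator _ _ _ ≪≫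
    Functor.isoWhiskerLeft _ (Adelman.embeddingExtIso (R := R) (matLift (freeLift R H))) ≪≫
      matEmbeddingLiftIso (freeLift R H)) ≪≫ freeEmbeddingLiftIso R H

end FreeAb

section Serre

variable {A : Type u} [Category.{v} A] [Abelian A]

/-- The smallest Serre class containing a class of objects of an abelian category. -/
def serreClosure (P : ObjectProperty A) : ObjectProperty A :=
  fun X ↦ ∀ Q : ObjectProperty A, Q.IsSerreClass → P ≤ Q → Q X

lemma le_serreClosure (P : ObjectProperty A) : P ≤ serreClosure P :=
  fun X hX _ _ h ↦ h X hX

lemma serreClosure_le {P Q : ObjectProperty A} [hQ : Q.IsSerreClass] (h : P ≤ Q) :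
    serreClosure P ≤ Q := fun _ hX ↦ hX Q hQ h

instance (P : ObjectProperty A) : (serreClosure P).IsSerreClass where
  exists_zero := by
    obtain ⟨Z, hZ⟩ : ∃ Z : A, IsZero Z := HasZeroObject.zero
    exact ⟨Z, hZ, fun Q _ _ ↦ Q.prop_of_isZero hZ⟩
  prop_of_mono f _ h Q hQ hP := Q.prop_of_mono f (h Q hQ hP)
  prop_of_epi f _ h Q hQ hP := Q.prop_of_epi f (h Q hQ hP)
  prop_X₂_of_shortExact hS h₁ h₃ Q hQ hP :=
    Q.prop_X₂_of_shortExact hS (h₁ Q hQ hP) (h₃ Q hQ hP)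

/-- The Serre quotient of an abelian category by a Serre class. -/
abbrev SerreQuotient (P : ObjectProperty A) [P.IsSerreClass] : Type u :=
  P.isoModSerre.Localization

namespace SerreQuotient

variable (P : ObjectProperty A) [P.IsSerreClass]

/-- The projection to the Serre quotient. -/
abbrev proj : A ⥤ SerreQuotient P := P.isoModSerre.Q

instance : Abelian (SerreQuotient P) := ObjectProperty.SerreClassLocalization.abelian (proj P) P

instance : PreservesFiniteLimits (proj P) :=
  ObjectProperty.SerreClassLocalization.preservesFiniteLimits (proj P) P

instance : PreservesFiniteColimits (proj P) :=
  ObjectProperty.SerreClassLocalization.preservesFiniteColimits (proj P) P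

lemma kernel_proj : (proj P).kernel = P := by
  ext X
  exact ObjectProperty.SerreClassLocalization.isZero_obj_iff (proj P) P X

variable {B : Type u'} [Category.{v'} B] [Abelian B] {P} (F : A ⥤ B) [PreservesFiniteLimits F]
  [PreservesFiniteColimits F] (hF : P ≤ F.kernel)

lemma isInvertedBy (hF : P ≤ F.kernel) : P.isoModSerre.IsInvertedBy F :=
  (P.isoModSerre_isInvertedBy_iff F).2 hF

/-- The exact functor on the Serre quotient induced by an exact functor. -/
def lift : SerreQuotient P ⥤ B := Localization.Construction.lift F (isInvertedBy F hF)

lemma proj_lift : proj P ⋙ lift F hF = F := Localization.Construction.fac _ _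

instance : PreservesFiniteLimits (lift F hF) := by
  rw [← ObjectProperty.SerreClassLocalization.preservesFiniteLimits_comp_iff (proj P) P, proj_lift]
  infer_instance

instance : PreservesFiniteColimits (lift F hF) := by
  rw [← ObjectProperty.SerreClassLocalization.preservesFiniteColimits_comp_iff (proj P) P,
    proj_lift]
  infer_instance

instance [F.Additive] : (lift F hF).Additive := by
  have : (proj P ⋙ lift F hF).Additive := by rw [proj_lift]; infer_instance
  exact (Localization.functor_additive_iff (proj P) P.isoModSerre (lift F hF)).2 this

lemma lift_linear (R : Type w) [CommRing R] [Linear R A] [Linear R B] [F.Linear R] :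
    (lift F hF).Linear R := by
  let : Localization.Lifting (proj P) P.isoModSerre F (lift F hF) :=
    ⟨eqToIso (proj_lift F hF)⟩
  exact (Localization.functor_linear_iff (proj P) P.isoModSerre R F (lift F hF)).1 inferInstance

end SerreQuotient

lemma map_eq_zero_iff_kernel {B : Type u'} [Category.{v'} B] [Abelian B] (F : A ⥤ B)
    [PreservesFiniteLimits F] [PreservesFiniteColimits F] {X Y : A} (f : X ⟶ Y) :
    F.map f = 0 ↔ F.kernel (Abelian.image f) := by
  have := preservesBinaryBiproducts_of_preservesBinaryProducts F
  have e : F.map f = F.map (Abelian.factorThruImage f) ≫ F.map (Abelian.image.ι f) := by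
    rw [← F.map_comp, Abelian.image.fac]
  constructor
  · intro h
    change IsZero (F.obj (Abelian.image f))
    rw [IsZero.iff_id_eq_zero,
      ← cancel_mono (F.map (Abelian.image.ι f)), ← cancel_epi (F.map (Abelian.factorThruImage f))]
    simp [← e, h]
  · intro h
    rw [e, IsZero.eq_zero_of_tgt h (F.map (Abelian.factorThruImage f)), zero_comp]

end Serre

section Axioms

/-- A set of axioms for the push-forwards of a universal theory with values in `A`: a set of
morphisms that have to become invertible, and a set of pairs of parallel morphisms that have to
become equal (commutativity of diagrams). -/
structure Axioms (A : Type u) [Category.{v} A] where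
  inv : MorphismProperty A
  eq : HomRel A

variable {A : Type u} [Category.{v} A]

/-- A functor satisfies the axioms. -/
structure Axioms.Satisfied (ax : Axioms A) {B : Type u'} [Category.{v'} B] (F : A ⥤ B) : Prop where
  isIso : ∀ ⦃X Y : A⦄ (f : X ⟶ Y), ax.inv f → IsIso (F.map f)
  map_eq : ∀ ⦃X Y : A⦄ (f g : X ⟶ Y), ax.eq f g → F.map f = F.map g

variable [Abelian A]

/-- The kernels and cokernels of the morphisms to be inverted, including the equalisers of the
pairs of morphisms to be identified. -/
inductive Axioms.Obstruction (ax : Axioms A) : ObjectProperty A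
  | kernel {X Y : A} (f : X ⟶ Y) (h : ax.inv f) : Obstruction ax (kernel f)
  | cokernel {X Y : A} (f : X ⟶ Y) (h : ax.inv f) : Obstruction ax (cokernel f)
  | kernel_equalizer {X Y : A} (f g : X ⟶ Y) (h : ax.eq f g) :
      Obstruction ax (Limits.kernel (equalizer.ι f g))
  | cokernel_equalizer {X Y : A} (f g : X ⟶ Y) (h : ax.eq f g) :
      Obstruction ax (Limits.cokernel (equalizer.ι f g))

/-- The smallest Serre subcategory containing kernels and cokernels of the morphisms to be
inverted. -/
def Axioms.serre (ax : Axioms A) : ObjectProperty A := serreClosure ax.Obstruction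

instance (ax : Axioms A) : ax.serre.IsSerreClass :=
  inferInstanceAs (serreClosure ax.Obstruction).IsSerreClass

end Axioms

section

variable {A : Type u} [Category.{v} A] [Abelian A] {ι : Type u'} (P : ι → ObjectProperty A)

lemma isSerreClass_iInf (hP : ∀ i, (P i).IsSerreClass) :
    ObjectProperty.IsSerreClass (fun X ↦ ∀ i, P i X) where
  exists_zero := by
    obtain ⟨Z, hZ⟩ : ∃ Z : A, IsZero Z := HasZeroObject.zero
    exact ⟨Z, hZ, fun i ↦ (P i).prop_of_isZero hZ⟩
  prop_of_mono f _ h i := (P i).prop_of_mono f (h i)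
  prop_of_epi f _ h i := (P i).prop_of_epi f (h i)
  prop_X₂_of_shortExact hS h₁ h₃ i := (P i).prop_X₂_of_shortExact hS (h₁ i) (h₃ i)

end

section Absolute

/-- A cohomology on `C` with values in `B`. -/
abbrev Cohomology (C : Type u) [Category.{v} C] (B : Type u') [Category.{v'} B] :=
  ℕ → Cᵒᵖ ⥤ B

namespace Cohomology

variable {C : Type u} [Category.{v} C] {B : Type u'} [Category.{v'} B]

/-- The push-forward of a cohomology along a functor. -/
def push {B' : Type u''} [Category.{v''} B'] (H : Cohomology C B) (F : B ⥤ B') :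
    Cohomology C B' := fun i ↦ H i ⋙ F

/-- Isomorphism of cohomologies. -/
def IsIsomorphic (H H' : Cohomology C B) : Prop := ∀ i, Nonempty (H i ≅ H' i)

/-- A cohomology as a single functor. -/
def toFunctor (H : Cohomology C B) : Discrete ℕ × Cᵒᵖ ⥤ B := Functor.uncurry.obj (Discrete.functor H)

/-- A cohomology is recovered from the associated functor. -/
def toFunctorIso (H : Cohomology C B) (i : ℕ) :
    Prod.sectR (⟨i⟩ : Discrete ℕ) Cᵒᵖ ⋙ H.toFunctor ≅ H i :=
  NatIso.ofComponents (fun X ↦ Iso.refl ((H i).obj X)) (by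
    intro X Y f
    refine (comp_id _).trans (Eq.trans ?_ (id_comp _).symm)
    change ((Discrete.functor H).map (𝟙 (Discrete.mk i))).app X ≫ (H i).map f = (H i).map f
    rw [CategoryTheory.Functor.map_id]
    exact id_comp _)

end Cohomology

variable (R : Type w) [CommRing R] (C : Type u) [Category.{v} C]

/-- The abelian category in which the universal cohomology takes values: the free abelian
`R`-linear category on `ℕ` (as a discrete category) times `Cᵒᵖ`. -/
abbrev AbUniv : Type (max 1 u v w) := FreeAb R (Discrete ℕ × Cᵒᵖ)

/-- The universal cohomology. -/
def univ : Cohomology C (AbUniv R C) :=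
  fun i ↦ Prod.sectR (⟨i⟩ : Discrete ℕ) Cᵒᵖ ⋙ FreeAb.unit R (Discrete ℕ × Cᵒᵖ)

variable {C} {B : Type u'} [Category.{v'} B] [Abelian B] [Linear R B]

/-- The properties of the functors along which cohomologies are pushed forward:
exact and `R`-linear functors. -/
structure IsExactLinear {A : Type u} [Category.{v} A] [Abelian A] [Linear R A] (F : A ⥤ B) :
    Prop where
  left : PreservesFiniteLimits F
  right : PreservesFiniteColimits F
  additive : F.Additive
  linear : F.Linear R

namespace Cohomology

/-- Every cohomology is the push-forward of the universal one. -/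
theorem exists_realization (H : Cohomology C B) :
    ∃ F : AbUniv R C ⥤ B, IsExactLinear R F ∧ ((univ R C).push F).IsIsomorphic H :=
  ⟨FreeAb.ext R H.toFunctor, ⟨inferInstance, inferInstance, inferInstance, inferInstance⟩,
    fun i ↦ ⟨Functor.associator _ _ _ ≪≫ Functor.isoWhiskerLeft _ (FreeAb.unitExtIso R _) ≪≫
      H.toFunctorIso i⟩⟩

/-- The exact `R`-linear functor (unique up to isomorphism) along which the push-forward of the
universal cohomology is `H`. -/
def realization (H : Cohomology C B) : AbUniv R C ⥤ B := (H.exists_realization R).choose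

lemma realization_isExactLinear (H : Cohomology C B) : IsExactLinear R (H.realization R) :=
  (H.exists_realization R).choose_spec.1

lemma realization_push (H : Cohomology C B) :
    ((univ R C).push (H.realization R)).IsIsomorphic H :=
  (H.exists_realization R).choose_spec.2

end Cohomology

variable (C)

/-- A cohomology on `C` with values in some abelian `R`-linear category. -/
structure Theory where
  B : Type s
  [cat : Category.{t} B]
  [abelian : Abelian B]
  [linear : Linear R B]
  H : Cohomology C B

attribute [instance] Theory.cat Theory.abelian Theory.linear

variable {R C}

/-- The exact functor of a cohomology theory. -/
abbrev Theory.F (T : Theory.{w, v, u, t, s} R C) : AbUniv R C ⥤ T.B := T.H.realization R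

/-- The intersection of the kernels of the exact functors given by a class of cohomologies. -/
def commonKernel (S : Set (Theory.{w, v, u, t, s} R C)) : ObjectProperty (AbUniv R C) :=
  fun X ↦ ∀ T ∈ S, T.F.kernel X

instance (S : Set (Theory.{w, v, u, t, s} R C)) : (commonKernel S).IsSerreClass := by
  have h : commonKernel S = fun X ↦ ∀ T : S, T.1.F.kernel X := by
    ext X
    simp [commonKernel]
  rw [h]
  refine isSerreClass_iInf _ fun T ↦ ?_
  have := (T.1.H.realization_isExactLinear R).left
  have := (T.1.H.realization_isExactLinear R).right
  infer_instance

end Absolute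

section Pairs

variable {C : Type u} [Category.{v} C] (M : MorphismProperty C)

/-- A pair: an arrow belonging to `M`. -/
structure Pair where
  {sub : C}
  {top : C}
  hom : sub ⟶ top
  mem : M hom

namespace Pair

variable {M}

/-- A morphism of pairs: a commutative square in `C`. -/
@[ext]
structure Hom (P Q : Pair M) where
  left : P.sub ⟶ Q.sub
  right : P.top ⟶ Q.top
  w : left ≫ Q.hom = P.hom ≫ right

instance : Category (Pair M) where
  Hom := Hom
  id P := ⟨𝟙 _, 𝟙 _, by simp⟩
  comp f g := ⟨f.left ≫ g.left, f.right ≫ g.right, by rw [assoc, g.w, ← assoc, f.w, assoc]⟩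
  id_comp f := Hom.ext (id_comp f.left) (id_comp f.right)
  comp_id f := Hom.ext (comp_id f.left) (comp_id f.right)
  assoc f g h := Hom.ext (assoc f.left g.left h.left) (assoc f.right g.right h.right)

/-- Constructor for morphisms of pairs. -/
def homMk {P Q : Pair M} (left : P.sub ⟶ Q.sub) (right : P.top ⟶ Q.top)
    (w : left ≫ Q.hom = P.hom ≫ right) : P ⟶ Q := ⟨left, right, w⟩

end Pair

/-- A triple `Z ⟶ Y ⟶ X` of two composable arrows in `M`. -/
structure Triple where
  {Z : C}
  {Y : C}
  {X : C}
  f : Z ⟶ Y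
  g : Y ⟶ X
  hf : M f
  hg : M g

variable {M}

/-- A morphism of triples. -/
structure TripleHom (t t' : Triple M) where
  z : t.Z ⟶ t'.Z
  y : t.Y ⟶ t'.Y
  x : t.X ⟶ t'.X
  wf : z ≫ t'.f = t.f ≫ y
  wg : y ≫ t'.g = t.g ≫ x

namespace Triple

/-- The pair `(Y, Z)` of a triple. -/
def YZ (t : Triple M) : Pair M := ⟨t.f, t.hf⟩

/-- The pair `(X, Y)` of a triple. -/
def XY (t : Triple M) : Pair M := ⟨t.g, t.hg⟩

variable [M.IsStableUnderComposition]

/-- The pair `(X, Z)` of a triple. -/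
def XZ (t : Triple M) : Pair M := ⟨t.f ≫ t.g, M.comp_mem _ _ t.hf t.hg⟩

/-- The morphism of pairs `(Y, Z) ⟶ (X, Z)`. -/
def i (t : Triple M) : t.YZ ⟶ t.XZ := Pair.homMk (𝟙 t.Z) t.g (id_comp _)

/-- The morphism of pairs `(X, Z) ⟶ (X, Y)`. -/
def j (t : Triple M) : t.XZ ⟶ t.XY := Pair.homMk t.f (𝟙 t.X) (comp_id _).symm

end Triple

/-- The morphism induced by a morphism of triples on the pairs `(Y, Z)`. -/
def TripleHom.YZ {t t' : Triple M} (τ : TripleHom t t') : t.YZ ⟶ t'.YZ :=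
  Pair.homMk τ.z τ.y τ.wf

/-- The morphism induced by a morphism of triples on the pairs `(X, Y)`. -/
def TripleHom.XY {t t' : Triple M} (τ : TripleHom t t') : t.XY ⟶ t'.XY :=
  Pair.homMk τ.y τ.x τ.wg

end Pairs

section ExactAt

variable {A : Type u} [Category.{v} A]

/-- Exactness of `X ⟶ Y ⟶ Z` at `Y`. -/
def ExactAt [Abelian A] {X Y Z : A} (a : X ⟶ Y) (b : Y ⟶ Z) : Prop :=
  ∃ w : a ≫ b = 0, (ShortComplex.mk a b w).Exact

lemma ExactAt.of_iso [Abelian A] {X Y Z X' Y' Z' : A} {a : X ⟶ Y} {b : Y ⟶ Z} (h : ExactAt a b)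
    {a' : X' ⟶ Y'} {b' : Y' ⟶ Z'} (e₁ : X' ≅ X) (e₂ : Y' ≅ Y) (e₃ : Z' ≅ Z)
    (ha : e₁.hom ≫ a = a' ≫ e₂.hom) (hb : e₂.hom ≫ b = b' ≫ e₃.hom) : ExactAt a' b' := by
  obtain ⟨w, h⟩ := h
  have w' : a' ≫ b' = 0 := by
    rw [← cancel_mono e₃.hom, assoc, ← hb, ← assoc, ← ha, assoc, w, zero_comp, comp_zero]
  exact ⟨w', (ShortComplex.exact_iff_of_iso (ShortComplex.isoMk (S₁ := ShortComplex.mk a' b' w')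
    (S₂ := ShortComplex.mk a b w) e₁ e₂ e₃ ha hb)).2 h⟩

lemma ExactAt.map [Abelian A] {X Y Z : A} {a : X ⟶ Y} {b : Y ⟶ Z} (h : ExactAt a b)
    {B : Type u'} [Category.{v'} B] [Abelian B] (F : A ⥤ B) [PreservesFiniteLimits F]
    [PreservesFiniteColimits F] : ExactAt (F.map a) (F.map b) := by
  obtain ⟨w, h⟩ := h
  exact ⟨_, h.map F⟩

lemma exactAt_iff [Abelian A] {X Y Z : A} (a : X ⟶ Y) (b : Y ⟶ Z) :
    ExactAt a b ↔ a ≫ b = 0 ∧ kernel.ι b ≫ cokernel.π a = 0 := by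
  constructor
  · rintro ⟨w, h⟩
    exact ⟨w, (ShortComplex.exact_iff_kernel_ι_comp_cokernel_π_zero _).1 h⟩
  · rintro ⟨w, h⟩
    exact ⟨w, (ShortComplex.exact_iff_kernel_ι_comp_cokernel_π_zero _).2 h⟩

/-- An exact functor makes a pair of composable morphisms exact if and only if it kills two
objects. -/
lemma exactAt_map_iff [Abelian A] {X Y Z : A} (a : X ⟶ Y) (b : Y ⟶ Z)
    {B : Type u'} [Category.{v'} B] [Abelian B] (F : A ⥤ B) [PreservesFiniteLimits F]
    [PreservesFiniteColimits F] : ExactAt (F.map a) (F.map b) ↔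
      F.kernel (Abelian.image (a ≫ b)) ∧ F.kernel (Abelian.image (kernel.ι b ≫ cokernel.π a)) := by
  rw [exactAt_iff, ← map_eq_zero_iff_kernel, ← map_eq_zero_iff_kernel, F.map_comp, F.map_comp,
    ← kernelComparison_comp_ι, ← π_comp_cokernelComparison]
  refine and_congr Iff.rfl ?_
  simp only [assoc]
  rw [← assoc (kernel.ι (F.map b)), ← assoc (kernelComparison b F)]
  constructor
  · intro h
    rw [h, comp_zero, zero_comp]
  · intro h
    have h' := inv (kernelComparison b F) ≫= h =≫ inv (cokernelComparison a F)
    rw [zero_comp, comp_zero, assoc, assoc, IsIso.inv_hom_id_assoc, IsIso.hom_inv_id,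
      comp_id] at h'
    exact h'

lemma mono_map_iff_kernel [Abelian A] {X Y : A} (a : X ⟶ Y)
    {B : Type u'} [Category.{v'} B] [Abelian B] (F : A ⥤ B) [PreservesFiniteLimits F]
    [PreservesFiniteColimits F] : Mono (F.map a) ↔ F.kernel (kernel a) := by
  rw [Preadditive.mono_iff_isZero_kernel, ← (PreservesKernel.iso F a).isZero_iff]
  rfl

end ExactAt

section Relative

variable {C : Type u} [Category.{v} C] (M : MorphismProperty C) [M.IsStableUnderComposition]

/-- A relative cohomology on the category of pairs given by `M`, with values in an abelian category `B`. -/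
structure RelCohomology (B : Type u') [Category.{v'} B] [Abelian B] where
  /-- the contravariant functors -/
  H : ℕ → (Pair M)ᵒᵖ ⥤ B
  /-- the boundary `Hⁱ(Y, Z) ⟶ Hⁱ⁺¹(X, Y)` of a triple -/
  δ : ∀ (i : ℕ) (t : Triple M), (H i).obj (op t.YZ) ⟶ (H (i + 1)).obj (op t.XY)
  /-- naturality of the boundary -/
  δ_natural : ∀ (i : ℕ) {t t' : Triple M} (τ : TripleHom t t'),
    δ i t' ≫ (H (i + 1)).map τ.XY.op = (H i).map τ.YZ.op ≫ δ i t
  /-- exactness of the long exact sequence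
  `0 ⟶ H⁰(X, Y) ⟶ ⋯ ⟶ Hⁱ(X, Y) ⟶ Hⁱ(X, Z) ⟶ Hⁱ(Y, Z) ⟶ Hⁱ⁺¹(X, Y) ⟶ ⋯` -/
  mono_zero : ∀ t : Triple M, Mono ((H 0).map t.j.op)
  exact₁ : ∀ (i : ℕ) (t : Triple M), ExactAt ((H i).map t.j.op) ((H i).map t.i.op)
  exact₂ : ∀ (i : ℕ) (t : Triple M), ExactAt ((H i).map t.i.op) (δ i t)
  exact₃ : ∀ (i : ℕ) (t : Triple M), ExactAt (δ i t) ((H (i + 1)).map t.j.op)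

namespace RelCohomology

variable {M} {B : Type u'} [Category.{v'} B] [Abelian B]

/-- The push-forward of a relative cohomology along an exact functor. -/
def push {B' : Type u''} [Category.{v''} B'] [Abelian B'] (H : RelCohomology M B) (F : B ⥤ B')
    [PreservesFiniteLimits F] [PreservesFiniteColimits F] : RelCohomology M B' where
  H i := H.H i ⋙ F
  δ i t := F.map (H.δ i t)
  δ_natural i t t' τ := by
    dsimp only [Functor.comp_map]
    rw [← F.map_comp, H.δ_natural, F.map_comp]
  mono_zero t := by
    have := H.mono_zero t
    dsimp only [Functor.comp_map]
    infer_instance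
  exact₁ i t := (H.exact₁ i t).map F
  exact₂ i t := (H.exact₂ i t).map F
  exact₃ i t := (H.exact₃ i t).map F

/-- Isomorphism of relative cohomologies. -/
def IsIsomorphic (H H' : RelCohomology M B) : Prop :=
  ∃ e : ∀ i, H.H i ≅ H'.H i, ∀ (i : ℕ) (t : Triple M),
    H.δ i t ≫ (e (i + 1)).hom.app (op t.XY) = (e i).hom.app (op t.YZ) ≫ H'.δ i t

end RelCohomology

/-- The vertices of the quiver freely generated by the structure maps of a relative cohomology. -/
structure RelVertex where
  deg : ℕ
  pair : Pair M

/-- The structure maps of a relative cohomology. -/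
inductive RelArrow : RelVertex M → RelVertex M → Type (max u v)
  | map (i : ℕ) {P Q : Pair M} (f : P ⟶ Q) : RelArrow ⟨i, Q⟩ ⟨i, P⟩
  | bdry (i : ℕ) (t : Triple M) : RelArrow ⟨i, t.YZ⟩ ⟨i + 1, t.XY⟩

instance : Quiver (RelVertex M) where
  Hom := RelArrow M

variable {M} in
/-- The arrow of the path category given by a morphism of pairs. -/
def RelVertex.map (i : ℕ) {P Q : Pair M} (f : P ⟶ Q) :
    (Paths.of (RelVertex M)).obj ⟨i, Q⟩ ⟶ (Paths.of (RelVertex M)).obj ⟨i, P⟩ :=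
  (Paths.of (RelVertex M)).map (RelArrow.map i f)

variable {M} in
/-- The arrow of the path category given by a boundary. -/
def RelVertex.bdry (i : ℕ) (t : Triple M) :
    (Paths.of (RelVertex M)).obj ⟨i, t.YZ⟩ ⟶ (Paths.of (RelVertex M)).obj ⟨i + 1, t.XY⟩ :=
  (Paths.of (RelVertex M)).map (RelArrow.bdry i t)

/-- Functoriality and naturality of the boundaries. -/
inductive RelRelation : HomRel (Paths (RelVertex M))
  | id (i : ℕ) (P : Pair M) : RelRelation (RelVertex.map i (𝟙 P)) (𝟙 _)
  | comp (i : ℕ) {P Q T : Pair M} (f : P ⟶ Q) (g : Q ⟶ T) :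
      RelRelation (RelVertex.map i (f ≫ g)) (RelVertex.map i g ≫ RelVertex.map i f)
  | natural (i : ℕ) {t t' : Triple M} (τ : TripleHom t t') :
      RelRelation (RelVertex.bdry i t' ≫ RelVertex.map (i + 1) τ.XY)
        (RelVertex.map i τ.YZ ≫ RelVertex.bdry i t)

/-- The category freely generated by the structure maps of a relative cohomology, modulo
functoriality and naturality of boundaries. -/
abbrev RelDiagram := CategoryTheory.Quotient (RelRelation M)

namespace RelDiagram

/-- The contravariant functors from pairs. -/
def H (i : ℕ) : (Pair M)ᵒᵖ ⥤ RelDiagram M where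
  obj P := (CategoryTheory.Quotient.functor (RelRelation M)).obj ((Paths.of (RelVertex M)).obj ⟨i, P.unop⟩)
  map f := (CategoryTheory.Quotient.functor (RelRelation M)).map (RelVertex.map i f.unop)
  map_id P := (CategoryTheory.Quotient.sound _ (RelRelation.id i P.unop)).trans (CategoryTheory.Functor.map_id _ _)
  map_comp f g := (CategoryTheory.Quotient.sound _ (RelRelation.comp i g.unop f.unop)).trans
    (Functor.map_comp _ _ _)

variable {M}

/-- The boundaries. -/
def δ (i : ℕ) (t : Triple M) : (H M i).obj (op t.YZ) ⟶ (H M (i + 1)).obj (op t.XY) :=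
  (CategoryTheory.Quotient.functor (RelRelation M)).map (RelVertex.bdry i t)

lemma δ_natural (i : ℕ) {t t' : Triple M} (τ : TripleHom t t') :
    δ i t' ≫ (H M (i + 1)).map τ.XY.op = (H M i).map τ.YZ.op ≫ δ i t :=
  (Functor.map_comp _ _ _).symm.trans
    ((CategoryTheory.Quotient.sound _ (RelRelation.natural i τ)).trans (Functor.map_comp _ _ _))

end RelDiagram

namespace RelCohomology

variable {M} {B : Type u'} [Category.{v'} B] [Abelian B] (H : RelCohomology M B)

/-- The underlying diagram of a relative cohomology. -/
def prefunctor : RelVertex M ⥤q B where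
  obj x := (H.H x.deg).obj (op x.pair)
  map {_ _} a := match a with
    | .map i f => (H.H i).map f.op
    | .bdry i t => H.δ i t

lemma pathsLift_map (i : ℕ) {P Q : Pair M} (f : P ⟶ Q) :
    (Paths.lift H.prefunctor).map (RelVertex.map i f) = (H.H i).map f.op :=
  Paths.lift_toPath _ _

lemma pathsLift_bdry (i : ℕ) (t : Triple M) :
    (Paths.lift H.prefunctor).map (RelVertex.bdry i t) = H.δ i t :=
  Paths.lift_toPath _ _

/-- A relative cohomology as a single functor. -/
def toFunctor : RelDiagram M ⥤ B :=
  CategoryTheory.Quotient.lift (RelRelation M) (Paths.lift H.prefunctor) (by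
    rintro _ _ _ _ (⟨i, P⟩ | ⟨i, f, g⟩ | ⟨i, τ⟩)
    · exact (H.pathsLift_map i (𝟙 P)).trans (((H.H i).map_id _).trans
        ((Paths.lift H.prefunctor).map_id ((Paths.of (RelVertex M)).obj ⟨i, P⟩)).symm)
    · rw [Functor.map_comp, pathsLift_map, pathsLift_map, pathsLift_map]
      exact (H.H i).map_comp _ _
    · rw [Functor.map_comp, Functor.map_comp, pathsLift_map, pathsLift_map, pathsLift_bdry,
        pathsLift_bdry]
      exact H.δ_natural i τ)

/-- A relative cohomology is recovered from the associated functor. -/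
def toFunctorIso (i : ℕ) : RelDiagram.H M i ⋙ H.toFunctor ≅ H.H i :=
  NatIso.ofComponents (fun P ↦ Iso.refl ((H.H i).obj P)) (by
    intro P Q f
    exact (comp_id _).trans ((H.pathsLift_map i f.unop).trans (id_comp _).symm))

lemma toFunctor_δ (i : ℕ) (t : Triple M) : H.toFunctor.map (RelDiagram.δ i t) = H.δ i t :=
  H.pathsLift_bdry i t

end RelCohomology

variable (R : Type w) [CommRing R]

/-- The objects that vanish when the long sequences of triples are exact. -/
inductive RelObstruction : ObjectProperty (FreeAb R (RelDiagram M))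
  | mono_zero (t : Triple M) :
      RelObstruction (kernel ((FreeAb.unit R _).map ((RelDiagram.H M 0).map t.j.op)))
  | comp₁ (i : ℕ) (t : Triple M) : RelObstruction (Abelian.image
      ((FreeAb.unit R _).map ((RelDiagram.H M i).map t.j.op) ≫
        (FreeAb.unit R _).map ((RelDiagram.H M i).map t.i.op)))
  | exact₁ (i : ℕ) (t : Triple M) : RelObstruction (Abelian.image
      (kernel.ι ((FreeAb.unit R _).map ((RelDiagram.H M i).map t.i.op)) ≫
        cokernel.π ((FreeAb.unit R _).map ((RelDiagram.H M i).map t.j.op))))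
  | comp₂ (i : ℕ) (t : Triple M) : RelObstruction (Abelian.image
      ((FreeAb.unit R _).map ((RelDiagram.H M i).map t.i.op) ≫
        (FreeAb.unit R _).map (RelDiagram.δ i t)))
  | exact₂ (i : ℕ) (t : Triple M) : RelObstruction (Abelian.image
      (kernel.ι ((FreeAb.unit R _).map (RelDiagram.δ i t)) ≫
        cokernel.π ((FreeAb.unit R _).map ((RelDiagram.H M i).map t.i.op))))
  | comp₃ (i : ℕ) (t : Triple M) : RelObstruction (Abelian.image
      ((FreeAb.unit R _).map (RelDiagram.δ i t) ≫
        (FreeAb.unit R _).map ((RelDiagram.H M (i + 1)).map t.j.op)))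
  | exact₃ (i : ℕ) (t : Triple M) : RelObstruction (Abelian.image
      (kernel.ι ((FreeAb.unit R _).map ((RelDiagram.H M (i + 1)).map t.j.op)) ≫
        cokernel.π ((FreeAb.unit R _).map (RelDiagram.δ i t))))

/-- The abelian category in which the universal relative cohomology takes values: the quotient of
the free abelian `R`-linear category on the structure maps by the smallest Serre class that makes
the long sequences of triples exact. -/
abbrev RelAbUniv : Type (max 1 u v w) := SerreQuotient (serreClosure (RelObstruction M R))

/-- The projection from the free abelian category. -/
abbrev RelAbUniv.proj : FreeAb R (RelDiagram M) ⥤ RelAbUniv M R := SerreQuotient.proj _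

lemma RelAbUniv.le_kernel :
    RelObstruction M R ≤ (RelAbUniv.proj M R).kernel := by
  rw [SerreQuotient.kernel_proj]
  exact le_serreClosure _

/-- The universal relative cohomology. -/
def relUniv : RelCohomology M (RelAbUniv M R) where
  H i := RelDiagram.H M i ⋙ FreeAb.unit R _ ⋙ RelAbUniv.proj M R
  δ i t := (FreeAb.unit R _ ⋙ RelAbUniv.proj M R).map (RelDiagram.δ i t)
  δ_natural i {_ _} τ := (Functor.map_comp _ _ _).symm.trans ((congrArg
    (FreeAb.unit R _ ⋙ RelAbUniv.proj M R).map (RelDiagram.δ_natural i τ)).trans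
      (Functor.map_comp _ _ _))
  mono_zero t := (mono_map_iff_kernel _ (RelAbUniv.proj M R)).2
    (RelAbUniv.le_kernel M R _ (.mono_zero t))
  exact₁ i t := (exactAt_map_iff _ _ (RelAbUniv.proj M R)).2
    ⟨RelAbUniv.le_kernel M R _ (.comp₁ i t), RelAbUniv.le_kernel M R _ (.exact₁ i t)⟩
  exact₂ i t := (exactAt_map_iff _ _ (RelAbUniv.proj M R)).2
    ⟨RelAbUniv.le_kernel M R _ (.comp₂ i t), RelAbUniv.le_kernel M R _ (.exact₂ i t)⟩
  exact₃ i t := (exactAt_map_iff _ _ (RelAbUniv.proj M R)).2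
    ⟨RelAbUniv.le_kernel M R _ (.comp₃ i t), RelAbUniv.le_kernel M R _ (.exact₃ i t)⟩

variable {M} {B : Type u'} [Category.{v'} B] [Abelian B] [Linear R B]

namespace RelCohomology

variable (H : RelCohomology M B)

/-- The exact functor on the free abelian category given by a relative cohomology. -/
def freeExt : FreeAb R (RelDiagram M) ⥤ B := FreeAb.ext R H.toFunctor

instance : (freeExt R H).Additive := inferInstanceAs (FreeAb.ext R H.toFunctor).Additive

instance : (freeExt R H).Linear R := inferInstanceAs ((FreeAb.ext R H.toFunctor).Linear R)

instance : PreservesFiniteLimits (freeExt R H) :=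
  inferInstanceAs (PreservesFiniteLimits (FreeAb.ext R H.toFunctor))

instance : PreservesFiniteColimits (freeExt R H) :=
  inferInstanceAs (PreservesFiniteColimits (FreeAb.ext R H.toFunctor))

/-- The value of `freeExt` on the contravariant functors. -/
def freeExtIso (i : ℕ) :
    RelDiagram.H M i ⋙ FreeAb.unit R _ ⋙ H.freeExt R ≅ H.H i :=
  Functor.isoWhiskerLeft _ (FreeAb.unitExtIso R H.toFunctor) ≪≫ H.toFunctorIso i

lemma freeExtIso_natural (i : ℕ) {P Q : Pair M} (f : P ⟶ Q) :
    ((H.freeExtIso R i).app (op Q)).hom ≫ (H.H i).map f.op =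
      (H.freeExt R).map ((FreeAb.unit R _).map ((RelDiagram.H M i).map f.op)) ≫
        ((H.freeExtIso R i).app (op P)).hom :=
  ((H.freeExtIso R i).hom.naturality f.op).symm

lemma freeExtIso_app (i : ℕ) (P : (Pair M)ᵒᵖ) : ((H.freeExtIso R i).app P).hom =
    (FreeAb.unitExtIso R H.toFunctor).hom.app ((RelDiagram.H M i).obj P) :=
  comp_id _

lemma freeExtIso_δ (i : ℕ) (t : Triple M) :
    ((H.freeExtIso R i).app (op t.YZ)).hom ≫ H.δ i t =
      (H.freeExt R).map ((FreeAb.unit R _).map (RelDiagram.δ i t)) ≫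
        ((H.freeExtIso R (i + 1)).app (op t.XY)).hom := by
  rw [freeExtIso_app, freeExtIso_app, ← toFunctor_δ]
  exact ((FreeAb.unitExtIso R H.toFunctor).hom.naturality (RelDiagram.δ i t)).symm

lemma le_kernel_freeExt : RelObstruction M R ≤ (H.freeExt R).kernel := by
  have h₀ (t : Triple M) : (H.freeExt R).kernel
      (kernel ((FreeAb.unit R _).map ((RelDiagram.H M 0).map t.j.op))) := by
    rw [← mono_map_iff_kernel]
    have := H.mono_zero t
    have e := H.freeExtIso_natural R 0 t.j
    have : Mono ((H.freeExt R).map ((FreeAb.unit R _).map ((RelDiagram.H M 0).map t.j.op)) ≫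
        ((H.freeExtIso R 0).app (op t.XZ)).hom) := e ▸ mono_comp _ _
    exact mono_of_mono _ ((H.freeExtIso R 0).app (op t.XZ)).hom
  have h₁ (i : ℕ) (t : Triple M) := (exactAt_map_iff _ _ (H.freeExt R)).1
    ((H.exact₁ i t).of_iso ((H.freeExtIso R i).app _) ((H.freeExtIso R i).app _)
      ((H.freeExtIso R i).app _) (H.freeExtIso_natural R i t.j) (H.freeExtIso_natural R i t.i))
  have h₂ (i : ℕ) (t : Triple M) := (exactAt_map_iff _ _ (H.freeExt R)).1
    ((H.exact₂ i t).of_iso ((H.freeExtIso R i).app _) ((H.freeExtIso R i).app _)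
      ((H.freeExtIso R (i + 1)).app _) (H.freeExtIso_natural R i t.i) (H.freeExtIso_δ R i t))
  have h₃ (i : ℕ) (t : Triple M) := (exactAt_map_iff _ _ (H.freeExt R)).1
    ((H.exact₃ i t).of_iso ((H.freeExtIso R i).app _) ((H.freeExtIso R (i + 1)).app _)
      ((H.freeExtIso R (i + 1)).app _) (H.freeExtIso_δ R i t)
      (H.freeExtIso_natural R (i + 1) t.j))
  intro X hX
  cases hX with
  | mono_zero t => exact h₀ t
  | comp₁ i t => exact (h₁ i t).1
  | exact₁ i t => exact (h₁ i t).2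
  | comp₂ i t => exact (h₂ i t).1
  | exact₂ i t => exact (h₂ i t).2
  | comp₃ i t => exact (h₃ i t).1
  | exact₃ i t => exact (h₃ i t).2

/-- The exact functor induced by a relative cohomology. -/
def ext : RelAbUniv M R ⥤ B :=
  haveI : (H.freeExt R).kernel.IsSerreClass := inferInstance
  SerreQuotient.lift (H.freeExt R) (serreClosure_le (H.le_kernel_freeExt R))

lemma proj_ext : RelAbUniv.proj M R ⋙ H.ext R = H.freeExt R := SerreQuotient.proj_lift _ _

lemma ext_isExactLinear : IsExactLinear R (H.ext R) where
  left := inferInstanceAs (PreservesFiniteLimits (SerreQuotient.lift (H.freeExt R) _))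
  right := inferInstanceAs (PreservesFiniteColimits (SerreQuotient.lift (H.freeExt R) _))
  additive := inferInstanceAs (SerreQuotient.lift (H.freeExt R) _).Additive
  linear := SerreQuotient.lift_linear _ _ R

/-- Every relative cohomology is the push-forward of the universal one. -/
theorem exists_realization : ∃ (F : RelAbUniv M R ⥤ B) (hF : IsExactLinear R F),
    haveI := hF.left
    haveI := hF.right
    ((relUniv M R).push F).IsIsomorphic H := by
  refine ⟨H.ext R, H.ext_isExactLinear R, ?_⟩
  have e : FreeAb.unit R (RelDiagram M) ⋙ RelAbUniv.proj M R ⋙ H.ext R ≅ H.toFunctor :=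
    Functor.isoWhiskerLeft _ (eqToIso (H.proj_ext R)) ≪≫ FreeAb.unitExtIso R H.toFunctor
  refine ⟨fun i ↦ Functor.isoWhiskerLeft (RelDiagram.H M i) e ≪≫ H.toFunctorIso i, fun i t ↦ ?_⟩
  have h (k : ℕ) (P : (Pair M)ᵒᵖ) :
      (Functor.isoWhiskerLeft (RelDiagram.H M k) e ≪≫ H.toFunctorIso k).hom.app P =
        e.hom.app ((RelDiagram.H M k).obj P) := comp_id _
  refine (congrArg _ (h (i + 1) _)).trans (Eq.trans ?_ (congrArg (· ≫ H.δ i t) (h i _)).symm)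
  rw [← H.toFunctor_δ]
  exact e.hom.naturality (RelDiagram.δ i t)

/-- The exact `R`-linear functor (unique up to isomorphism) along which the push-forward of the
universal relative cohomology is `H`. -/
def realization : RelAbUniv M R ⥤ B := (H.exists_realization R).choose

lemma realization_isExactLinear : IsExactLinear R (H.realization R) :=
  (H.exists_realization R).choose_spec.choose

instance : PreservesFiniteLimits (H.realization R) := (H.realization_isExactLinear R).left

instance : PreservesFiniteColimits (H.realization R) := (H.realization_isExactLinear R).right

lemma realization_push : ((relUniv M R).push (H.realization R)).IsIsomorphic H :=
  (H.exists_realization R).choose_spec.choose_spec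

end RelCohomology

variable (M)

/-- A relative cohomology on the pairs in `M` with values in some abelian `R`-linear category. -/
structure RelTheory where
  B : Type s
  [cat : Category.{t} B]
  [abelian : Abelian B]
  [linear : Linear R B]
  H : RelCohomology M B

attribute [instance] RelTheory.cat RelTheory.abelian RelTheory.linear

variable {R M}

/-- The exact functor of a relative cohomology theory. -/
abbrev RelTheory.F (T : RelTheory.{w, v, u, t, s} M R) : RelAbUniv M R ⥤ T.B := T.H.realization R

/-- The intersection of the kernels of the exact functors given by a class of relative
cohomologies. -/
def relCommonKernel (S : Set (RelTheory.{w, v, u, t, s} M R)) : ObjectProperty (RelAbUniv M R) :=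
  fun X ↦ ∀ T ∈ S, T.F.kernel X

instance (S : Set (RelTheory.{w, v, u, t, s} M R)) : (relCommonKernel S).IsSerreClass := by
  have h : relCommonKernel S = fun X ↦ ∀ T : S, T.1.F.kernel X := by
    ext X
    simp [relCommonKernel]
  rw [h]
  exact isSerreClass_iInf _ fun T ↦ inferInstance

end Relative

end UniversalCohomology

end

open UniversalCohomology

universe w v u t s

universe v' u' v'' u''

noncomputable section

/-! An exact functor inverts a morphism exactly when it kills its kernel and cokernel, and it
identifies `f` and `g` exactly when it inverts their equaliser. So satisfying the axioms is a
condition on the kernel of the functor alone: it must contain the obstructions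
(`Axioms.satisfied_iff`). This kernel is a Serre class, so for every cohomology satisfying the
axioms it contains the whole Serre class generated by the obstructions. That is one inclusion.

For the other inclusion a single cohomology suffices, namely the push-forward of the universal one
along the projection to the Serre quotient, whose kernel is exactly that class. The functor attached
to this cohomology, however, is merely some exact `R`-linear functor whose push-forward is
isomorphic to it, so it has to be shown that it has the same kernel as the projection.

Uniqueness of realizations is needed only at the level of kernels. An object of Adelman's category
is the image of a map from the kernel of `q` to the cokernel of `p`. Hence an exact additive functor
kills it if and only if a condition on the images of `p` and `q` holds, which depends only on the
restriction to the underlying additive category (`Adelman.isZero_obj_iff`). On matrices over a free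
`R`-linear category, a linear functor is determined by its values on the original category, and
`FreeAb.kernel_eq` follows. In the relative case the universal category is itself a Serre quotient
of a free abelian category, and kernels are compared after composing with that projection.

The classes of theories live in fixed, sufficiently large universes, so the Serre quotient is first
replaced by an equivalent copy there. -/

namespace UniversalCohomology

/-! ### Vanishing of the map from a kernel to a cokernel -/

section Vanishing

variable {A : Type u} [Category.{v} A] [Preadditive A]

/-- The induced map from the kernel of `b` to the cokernel of `a` vanishes. -/
def SubquotientVanishes {X Y Z : A} (a : X ⟶ Y) (b : Y ⟶ Z) : Prop :=
  ∀ ⦃W T : A⦄ (x : W ⟶ Y) (y : Y ⟶ T), x ≫ b = 0 → a ≫ y = 0 → x ≫ y = 0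

lemma SubquotientVanishes.of_iso {X Y Z X' Y' Z' : A} {a : X ⟶ Y} {b : Y ⟶ Z}
    {a' : X' ⟶ Y'} {b' : Y' ⟶ Z'} (h : SubquotientVanishes a b) (e₁ : X ≅ X') (e₂ : Y ≅ Y')
    (e₃ : Z ≅ Z') (ha : a ≫ e₂.hom = e₁.hom ≫ a') (hb : b ≫ e₃.hom = e₂.hom ≫ b') :
    SubquotientVanishes a' b' := by
  intro W T x y hx hy
  have := h (x ≫ e₂.inv) (e₂.hom ≫ y)
    (by rw [← cancel_mono e₃.hom, assoc, assoc, hb, e₂.inv_hom_id_assoc, hx, zero_comp])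
    (by rw [← assoc, ha, assoc, hy, comp_zero])
  simpa using this

lemma subquotientVanishes_congr {V : Type u'} [Category.{v'} V] {L L' : V ⥤ A} (e : L ≅ L')
    {X Y Z : V} (a : X ⟶ Y) (b : Y ⟶ Z) :
    SubquotientVanishes (L.map a) (L.map b) ↔ SubquotientVanishes (L'.map a) (L'.map b) :=
  ⟨fun h ↦ h.of_iso (e.app _) (e.app _) (e.app _) (e.hom.naturality _) (e.hom.naturality _),
    fun h ↦ h.of_iso (e.symm.app _) (e.symm.app _) (e.symm.app _) (e.inv.naturality _)
      (e.inv.naturality _)⟩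

/-- An exact functor preserves the given kernel and cokernel, so every test morphism killed by
`F.map b` factors through `F.map k`, and every test morphism killing `F.map a` factors through
`F.map c`. The pair `F.map k`, `F.map c` is therefore the universal test. The right-hand side
mentions neither kernels nor cokernels, which is what makes it easy to transport. -/
lemma map_kernel_comp_cokernel_eq_zero_iff {B : Type u'} [Category.{v'} B] [Preadditive B]
    (F : A ⥤ B) [PreservesFiniteLimits F] [PreservesFiniteColimits F] [F.Additive]
    {X Y Z K C : A} {a : X ⟶ Y} {b : Y ⟶ Z} {k : K ⟶ Y} {c : Y ⟶ C} {wk : k ≫ b = 0}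
    {wc : a ≫ c = 0} (hk : IsLimit (KernelFork.ofι k wk))
    (hc : IsColimit (CokernelCofork.ofπ c wc)) :
    F.map (k ≫ c) = 0 ↔ SubquotientVanishes (F.map a) (F.map b) := by
  constructor
  · intro h W T x y hx hy
    obtain ⟨x', rfl⟩ := KernelFork.IsLimit.lift' (isLimitForkMapOfIsLimit' F wk hk) x hx
    obtain ⟨y', rfl⟩ :=
      CokernelCofork.IsColimit.desc' (isColimitCoforkMapOfIsColimit' F wc hc) y hy
    change (x' ≫ F.map k) ≫ F.map c ≫ y' = 0
    rw [assoc, ← assoc (F.map k), ← F.map_comp, h, zero_comp, comp_zero]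
  · intro h
    rw [F.map_comp]
    exact h _ _ (by rw [← F.map_comp, wk, F.map_zero]) (by rw [← F.map_comp, wc, F.map_zero])

end Vanishing

/-! ### Objects of Adelman's category as images, and when an exact functor kills them -/

namespace Adelman

variable {R : Type w} [CommRing R] {V : Type u} [Category.{v} V] [Preadditive V] [Linear R V]
  [HasBinaryBiproducts V] [HasZeroObject V] (X : Adelman R V)

/-- The epimorphism onto a sequence from the kernel of its second morphism. -/
def fromKer : kerObj (X := embObj R X.mid) (Y := embObj R X.tgt) X.q ⟶ X :=
  homMk biprod.fst (mem_good 0 biprod.snd (by simp) (by simp))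

/-- The monomorphism from a sequence to the cokernel of its first morphism. -/
def toCoker : X ⟶ cokerObj (X := embObj R X.src) (Y := embObj R X.mid) X.p :=
  homMk biprod.inl (mem_good biprod.inr 0 (by simp) (by simp))

instance : Epi (fromKer X) := by
  rw [Preadditive.epi_iff_cancel_zero]
  intro Z φ hφ
  obtain ⟨g, _, rfl⟩ := exists_homMk φ
  rw [fromKer, homMk_comp, homMk_eq_zero_iff] at hφ
  obtain ⟨s, t, h⟩ := hφ
  rw [homMk_eq_zero_iff]
  -- Since `biprod.inl` splits `biprod.fst`, a null decomposition of `biprod.fst ≫ g` restricts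
  -- along it to one of `g`. The second morphism of the kernel object becomes `X.q ≫ biprod.inr`,
  -- whence `biprod.inr ≫ t`.
  exact ⟨biprod.inl ≫ s, biprod.inr ≫ t, by simpa using biprod.inl ≫= h⟩

instance : Mono (toCoker X) := by
  rw [Preadditive.mono_iff_cancel_zero]
  intro Z φ hφ
  obtain ⟨g, _, rfl⟩ := exists_homMk φ
  rw [toCoker, homMk_comp, homMk_eq_zero_iff] at hφ
  obtain ⟨s, t, h⟩ := hφ
  rw [homMk_eq_zero_iff]
  exact ⟨s ≫ biprod.snd, t ≫ biprod.fst, by simpa using h =≫ biprod.fst⟩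

/-- Together with the two preceding instances this exhibits `X` as the image of the map from kernel
to cokernel. Both composites are represented by `biprod.fst ≫ biprod.inl`. -/
lemma fromKer_toCoker : fromKer X ≫ toCoker X =
    kerι (X := embObj R X.mid) (Y := embObj R X.tgt) X.q ≫
      cokerπ (X := embObj R X.src) (Y := embObj R X.mid) X.p := rfl

variable {X} {B : Type u'} [Category.{v'} B] [Abelian B]

/-- The functor sends `fromKer X` to an epimorphism and `toCoker X` to a monomorphism, so `F.obj X`
vanishes if and only if their composite does. The resulting condition involves only the restriction
of `F` to `V`; this is why kernels can be compared without comparing the functors on all of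
Adelman's category. -/
lemma isZero_obj_iff (F : Adelman R V ⥤ B) [PreservesFiniteLimits F] [PreservesFiniteColimits F]
    [F.Additive] : IsZero (F.obj X) ↔ SubquotientVanishes ((embedding R V ⋙ F).map X.p)
      ((embedding R V ⋙ F).map X.q) := by
  refine Iff.trans ?_ (map_kernel_comp_cokernel_eq_zero_iff F
    (kerIsLimit (X := embObj R X.mid) (Y := embObj R X.tgt) X.q
      (mem_good 0 0 (by simp) (by simp)))
    (cokerIsColimit (X := embObj R X.src) (Y := embObj R X.mid) X.p
      (mem_good 0 0 (by simp) (by simp))))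
  refine Iff.trans ?_ (Iff.of_eq (congrArg (fun f ↦ F.map f = 0) (fromKer_toCoker X)))
  rw [F.map_comp]
  constructor
  · intro h
    rw [h.eq_zero_of_tgt (F.map (fromKer X)), zero_comp]
  · intro h
    rw [IsZero.iff_id_eq_zero, ← cancel_mono (F.map (toCoker X)),
      ← cancel_epi (F.map (fromKer X)), id_comp, h, zero_comp, comp_zero]

end Adelman

/-! ### Linear functors are determined by their restriction to the generating category -/

section Uniqueness

variable (R : Type w) [CommRing R]

section

variable {D : Type u} [Category.{v} D] {B : Type u'} [Category.{v'} B] [Preadditive B]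
  [Linear R B] {F G : Free R D ⥤ B} [F.Additive] [F.Linear R] [G.Additive] [G.Linear R]

/-- Both sides are `R`-linear in `f`, so it is enough to treat basis elements. -/
lemma free_map_comp_eq {X Y : D} (a : F.obj (Free.of R X) ⟶ G.obj (Free.of R X))
    (b : F.obj (Free.of R Y) ⟶ G.obj (Free.of R Y))
    (h : ∀ f : X ⟶ Y, F.map (ofCoeff R (.single f 1)) ≫ b = a ≫ G.map (ofCoeff R (.single f 1)))
    (f : (X ⟶ Y) →₀ R) : F.map (ofCoeff R f) ≫ b = a ≫ G.map (ofCoeff R f) := by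
  induction f using Finsupp.induction_linear with
  | zero =>
    have e : ofCoeff R (0 : (X ⟶ Y) →₀ R) = 0 := rfl
    rw [e, F.map_zero, G.map_zero, zero_comp, comp_zero]
  | add f g hf hg =>
    have e : ofCoeff R (f + g) = ofCoeff R f + ofCoeff R g := rfl
    rw [e, F.map_add, G.map_add, add_comp, comp_add, hf, hg]
  | single f r =>
    have e : ofCoeff R (.single f r) = r • ofCoeff R (.single f 1) :=
      (congrArg (ofCoeff R) (by rw [Finsupp.smul_single, smul_eq_mul, mul_one])).trans
        (rfl : ofCoeff R (r • Finsupp.single f 1) = _)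
    rw [e, F.map_smul, G.map_smul, Linear.smul_comp, Linear.comp_smul, h]

/-- `R`-linear functors on a free `R`-linear category are determined by their restrictions. -/
def freeExtIso (α : Free.embedding R D ⋙ F ≅ Free.embedding R D ⋙ G) : F ≅ G :=
  NatIso.ofComponents (fun X ↦ α.app X) fun f ↦
    free_map_comp_eq R _ _ (fun f ↦ α.hom.naturality f) (coeff R f)

end

section

variable {V : Type u} [Category.{v} V] [Preadditive V] {B : Type u'} [Category.{v'} B]
  [Preadditive B]

/-- The projections of a tuple to its components. -/
def matπ (M : Mat_ V) (i : M.ι) : M ⟶ (Mat_.embedding V).obj (M.X i) :=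
  M.isoBiproductEmbedding.hom ≫ biproduct.π _ i

/-- The inclusions of the components in a tuple. -/
def matι (M : Mat_ V) (i : M.ι) : (Mat_.embedding V).obj (M.X i) ⟶ M :=
  biproduct.ι (fun i ↦ (Mat_.embedding V).obj (M.X i)) i ≫ M.isoBiproductEmbedding.inv

/-- A tuple is the biproduct of its components. Additive functors preserve this decomposition of the
identity, so no biproducts are required in the target category. -/
lemma mat_total (M : Mat_ V) : ∑ i, matπ M i ≫ matι M i = 𝟙 M := by
  have h : ∑ i, matπ M i ≫ matι M i = M.isoBiproductEmbedding.hom ≫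
      (∑ i, biproduct.π _ i ≫ biproduct.ι (fun i ↦ (Mat_.embedding V).obj (M.X i)) i) ≫
        M.isoBiproductEmbedding.inv := by
    simp only [matπ, matι, assoc, comp_sum, sum_comp]
  rw [h, biproduct.total, id_comp, Iso.hom_inv_id]

variable {F G : Mat_ V ⥤ B}

/-- The extension of a natural transformation from one-by-one matrices to all matrices. -/
def matTrans (α : Mat_.embedding V ⋙ F ⟶ Mat_.embedding V ⋙ G) (M : Mat_ V) :
    F.obj M ⟶ G.obj M :=
  ∑ i, F.map (matπ M i) ≫ α.app (M.X i) ≫ G.map (matι M i)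

/-- The embedding is full, so naturality covers every matrix between two one-by-one objects, in
particular the components `f ≫ matπ M i`. -/
lemma map_comp_app_embedding (α : Mat_.embedding V ⋙ F ⟶ Mat_.embedding V ⋙ G) {x y : V}
    (f : (Mat_.embedding V).obj x ⟶ (Mat_.embedding V).obj y) :
    F.map f ≫ α.app y = α.app x ≫ G.map f := by
  obtain ⟨f, rfl⟩ := (Mat_.embedding V).map_surjective f
  exact α.naturality f

variable [F.Additive] [G.Additive]

/-- Each component `f ≫ matπ M i` moves past `α` by naturality, and the sum is reassembled by
`mat_total`. With `f` an inclusion this characterises `matTrans`; for general `f` it supplies the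
naturality. -/
lemma map_matι_comp_matTrans (α : Mat_.embedding V ⋙ F ⟶ Mat_.embedding V ⋙ G) {x : V}
    {M : Mat_ V} (f : (Mat_.embedding V).obj x ⟶ M) :
    F.map f ≫ matTrans α M = α.app x ≫ G.map f := by
  have h (i : M.ι) : F.map f ≫ F.map (matπ M i) ≫ α.app (M.X i) ≫ G.map (matι M i) =
      α.app x ≫ G.map (f ≫ matπ M i ≫ matι M i) := by
    rw [← F.map_comp_assoc, ← assoc, map_comp_app_embedding, assoc, ← G.map_comp, assoc]
  rw [matTrans, comp_sum, Finset.sum_congr rfl (fun i _ ↦ h i), ← comp_sum, ← G.map_sum,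
    ← comp_sum, mat_total, comp_id]

lemma mat_hom_ext {M : Mat_ V} {Z : B} {a b : F.obj M ⟶ Z}
    (h : ∀ i, F.map (matι M i) ≫ a = F.map (matι M i) ≫ b) : a = b := by
  have e (c : F.obj M ⟶ Z) : c = ∑ i, F.map (matπ M i) ≫ F.map (matι M i) ≫ c := by
    simp only [← F.map_comp_assoc]
    rw [← sum_comp, ← F.map_sum, mat_total, F.map_id, id_comp]
  rw [e a, e b]
  exact Finset.sum_congr rfl fun i _ ↦ by rw [h i]

lemma matTrans_comp_matTrans {α : Mat_.embedding V ⋙ F ⟶ Mat_.embedding V ⋙ G}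
    {β : Mat_.embedding V ⋙ G ⟶ Mat_.embedding V ⋙ F} (h : α ≫ β = 𝟙 _) (M : Mat_ V) :
    matTrans α M ≫ matTrans β M = 𝟙 _ := by
  apply mat_hom_ext
  intro i
  rw [← assoc, map_matι_comp_matTrans, assoc, map_matι_comp_matTrans, ← assoc, ← NatTrans.comp_app,
    h, NatTrans.id_app, comp_id]
  exact id_comp _

/-- Additive functors on a category of matrices are determined by their restrictions. -/
def matExtIso (α : Mat_.embedding V ⋙ F ≅ Mat_.embedding V ⋙ G) : F ≅ G :=
  NatIso.ofComponents (fun M ↦ ⟨matTrans α.hom M, matTrans α.inv M,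
    matTrans_comp_matTrans α.hom_inv_id M, matTrans_comp_matTrans α.inv_hom_id M⟩) (by
    intro M N f
    apply mat_hom_ext
    intro i
    dsimp only
    -- The composite `matι M i ≫ f` again starts at a one-by-one object, so the same lemma evaluates
    -- both sides.
    rw [← F.map_comp_assoc, map_matι_comp_matTrans, ← assoc, map_matι_comp_matTrans, assoc,
      ← G.map_comp])

end

instance {V : Type u} [Category.{v} V] [Preadditive V] [Linear R V] :
    (Mat_.embedding V).Linear R where

variable {R} {D : Type u} [Category.{v} D] {B : Type u'} [Category.{v'} B] [Abelian B]
  [Linear R B]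

/-- An exact `R`-linear functor on the free abelian category has the kernel determined by its
restriction. -/
lemma FreeAb.kernel_eq {F G : FreeAb R D ⥤ B} (hF : IsExactLinear R F) (hG : IsExactLinear R G)
    (α : FreeAb.unit R D ⋙ F ≅ FreeAb.unit R D ⋙ G) : F.kernel = G.kernel := by
  have := hF.left
  have := hF.right
  have := hF.additive
  have := hF.linear
  have := hG.left
  have := hG.right
  have := hG.additive
  have := hG.linear
  ext X
  -- By definition `FreeAb.unit` is a composite of three embeddings. The isomorphism `α` is extended
  -- along the first two only, to linear combinations and then to matrices, which is all that the
  -- vanishing criterion sees.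
  refine (Adelman.isZero_obj_iff F).trans (Iff.trans (subquotientVanishes_congr
    (matExtIso (freeExtIso R
      (F := Mat_.embedding _ ⋙ Adelman.embedding R _ ⋙ F)
      (G := Mat_.embedding _ ⋙ Adelman.embedding R _ ⋙ G) α)) _ _) (Adelman.isZero_obj_iff G).symm)

end Uniqueness

/-! ### The axioms as a condition on the kernel of an exact functor -/

section Satisfied

variable {A : Type u} [Category.{v} A] [Abelian A] {B : Type u'} [Category.{v'} B] [Abelian B]
  (F : A ⥤ B) [PreservesFiniteLimits F] [PreservesFiniteColimits F]

lemma epi_map_iff_kernel {X Y : A} (a : X ⟶ Y) : Epi (F.map a) ↔ F.kernel (cokernel a) := by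
  rw [Preadditive.epi_iff_isZero_cokernel, ← (PreservesCokernel.iso F a).isZero_iff]
  rfl

lemma isIso_map_iff_kernel {X Y : A} (a : X ⟶ Y) :
    IsIso (F.map a) ↔ F.kernel (kernel a) ∧ F.kernel (cokernel a) := by
  rw [isIso_iff_mono_and_epi, mono_map_iff_kernel, epi_map_iff_kernel]

/-- The functor preserves the equaliser, and the equaliser of two equal morphisms is invertible;
conversely, an invertible equaliser map can be cancelled. Commutativity axioms thereby become
invertibility axioms. -/
lemma map_eq_iff_isIso_map_equalizer_ι {X Y : A} (f g : X ⟶ Y) :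
    F.map f = F.map g ↔ IsIso (F.map (equalizer.ι f g)) := by
  constructor
  · intro h
    exact isIso_limit_cone_parallelPair_of_eq h (isLimitOfHasEqualizerOfPreservesLimit F f g)
  · intro h
    rw [← cancel_epi (F.map (equalizer.ι f g)), ← F.map_comp, ← F.map_comp, equalizer.condition]

/-- An exact functor satisfies the axioms if and only if it kills the obstructions. -/
lemma Axioms.satisfied_iff (ax : Axioms A) : ax.Satisfied F ↔ ax.Obstruction ≤ F.kernel := by
  constructor
  · rintro h X (⟨f, hf⟩ | ⟨f, hf⟩ | ⟨f, g, hfg⟩ | ⟨f, g, hfg⟩)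
    · exact ((isIso_map_iff_kernel F f).1 (h.isIso f hf)).1
    · exact ((isIso_map_iff_kernel F f).1 (h.isIso f hf)).2
    · exact ((isIso_map_iff_kernel F _).1
        ((map_eq_iff_isIso_map_equalizer_ι F f g).1 (h.map_eq f g hfg))).1
    · exact ((isIso_map_iff_kernel F _).1
        ((map_eq_iff_isIso_map_equalizer_ι F f g).1 (h.map_eq f g hfg))).2
  · intro h
    exact ⟨fun X Y f hf ↦ (isIso_map_iff_kernel F f).2 ⟨h _ (.kernel f hf), h _ (.cokernel f hf)⟩,
      fun X Y f g hfg ↦ (map_eq_iff_isIso_map_equalizer_ι F f g).2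
        ((isIso_map_iff_kernel F _).2
          ⟨h _ (.kernel_equalizer f g hfg), h _ (.cokernel_equalizer f g hfg)⟩)⟩

/-- The kernel of an exact functor is a Serre class, so it contains the closure of the obstructions
as soon as it contains the obstructions. -/
lemma Axioms.serre_le_kernel {ax : Axioms A} (h : ax.Satisfied F) : ax.serre ≤ F.kernel :=
  serreClosure_le ((ax.satisfied_iff F).1 h)

lemma Axioms.satisfied_of_kernel_eq {ax : Axioms A} (h : F.kernel = ax.serre) :
    ax.Satisfied F := by
  rw [ax.satisfied_iff F, h]
  exact le_serreClosure _

end Satisfied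

/-! ### Enlarging the universes of the Serre quotient -/

section UniverseLift

attribute [local instance] uliftCategory

/-- A copy of a category in larger universes. -/
abbrev UniverseLift (B : Type u) := ULiftHom.{t} (ULift.{s} B)

variable {B : Type u} [Category.{v} B] {R : Type w} [CommRing R]

instance [Preadditive B] : Preadditive (UniverseLift.{u, t, s} B) where
  homGroup X Y := inferInstanceAs (AddCommGroup (ULift (X.objDown.down ⟶ Y.objDown.down)))
  add_comp X Y Z f f' g := ULift.ext _ _ (add_comp X.objDown.down Y.objDown.down
    Z.objDown.down f.down f'.down g.down)
  comp_add X Y Z f g g' := ULift.ext _ _ (comp_add X.objDown.down Y.objDown.down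
    Z.objDown.down f.down g.down g'.down)

instance [Preadditive B] [Linear R B] : Linear R (UniverseLift.{u, t, s} B) where
  homModule X Y := inferInstanceAs (Module R (ULift (X.objDown.down ⟶ Y.objDown.down)))
  smul_comp X Y Z r f g := ULift.ext _ _ (Linear.smul_comp X.objDown.down Y.objDown.down
    Z.objDown.down r f.down g.down)
  comp_smul X Y Z f r g := ULift.ext _ _ (Linear.comp_smul X.objDown.down Y.objDown.down
    Z.objDown.down f.down r g.down)

instance [Preadditive B] : (ULiftHomULiftCategory.equiv.{t, s} B).functor.Additive where
  map_add := rfl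

instance [Preadditive B] : (ULiftHomULiftCategory.equiv.{t, s} B).inverse.Additive where
  map_add := rfl

instance [Preadditive B] [Linear R B] :
    (ULiftHomULiftCategory.equiv.{t, s} B).functor.Linear R where
  map_smul _ _ := rfl

instance [Abelian B] : Abelian (UniverseLift.{u, t, s} B) :=
  -- `abelianOfEquivalence` takes finite products and the additive structure as given. The hom
  -- groups defined above are kept, so the result is compatible with the `R`-linear structure.
  have : HasFiniteProducts (UniverseLift.{u, t, s} B) := ⟨fun _ ↦
    Adjunction.hasLimitsOfShape_of_equivalence (ULiftHomULiftCategory.equiv B).inverse⟩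
  abelianOfEquivalence (ULiftHomULiftCategory.equiv B).inverse

variable [Abelian B] [Linear R B]

lemma isExactLinear_universeLift :
    IsExactLinear R (ULiftHomULiftCategory.equiv.{t, s} B).functor where
  left := inferInstance
  right := inferInstance
  additive := inferInstance
  linear := inferInstance

lemma IsExactLinear.comp {A : Type u'} [Category.{v'} A] [Abelian A] [Linear R A]
    {B' : Type u''} [Category.{v''} B'] [Abelian B'] [Linear R B'] {F : A ⥤ B} {G : B ⥤ B'}
    (hF : IsExactLinear R F) (hG : IsExactLinear R G) : IsExactLinear R (F ⋙ G) := by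
  have := hF.left
  have := hF.right
  have := hF.additive
  have := hF.linear
  have := hG.left
  have := hG.right
  have := hG.additive
  have := hG.linear
  exact ⟨inferInstance, inferInstance, inferInstance, inferInstance⟩

lemma SerreQuotient.isExactLinear_proj (P : ObjectProperty B) [P.IsSerreClass] :
    IsExactLinear R (SerreQuotient.proj P) where
  left := inferInstance
  right := inferInstance
  additive := inferInstance
  linear := inferInstance

/-- A Serre class is the kernel of an exact linear functor to a category in larger universes. -/
lemma exists_exactLinear_kernel_eq (P : ObjectProperty B) [P.IsSerreClass] :
    ∃ (B' : Type max u s) (_ : Category.{max u v t} B') (_ : Abelian B') (_ : Linear R B')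
      (F : B ⥤ B'), IsExactLinear R F ∧ F.kernel = P := by
  refine ⟨UniverseLift.{_, t, s} (SerreQuotient P), inferInstance, inferInstance, inferInstance,
    SerreQuotient.proj P ⋙ (ULiftHomULiftCategory.equiv.{t, s} _).functor,
    (SerreQuotient.isExactLinear_proj P).comp isExactLinear_universeLift, ?_⟩
  -- Only the right-hand side may be rewritten: `P` also occurs on the left, inside the quotient
  -- category.
  conv_rhs => rw [← SerreQuotient.kernel_proj P]
  ext X
  -- An equivalence preserves and reflects zero objects, so lifting the universes leaves the kernel
  -- unchanged.
  exact ⟨fun h ↦ (((ULiftHomULiftCategory.equiv.{t, s} _).inverse.map_isZero h).of_iso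
    ((ULiftHomULiftCategory.equiv.{t, s} _).unitIso.app _)), 
    fun h ↦ (ULiftHomULiftCategory.equiv.{t, s} _).functor.map_isZero h⟩

end UniverseLift

/-! ### The absolute case -/

section Absolute

variable {R : Type w} [CommRing R] {C : Type u} [Category.{v} C] {B : Type u'} [Category.{v'} B]
  [Abelian B] [Linear R B]

/-- Functors on the product with a discrete category can be compared degree by degree. -/
def isoOfSectR {L L' : Discrete ℕ × Cᵒᵖ ⥤ B}
    (e : ∀ i, Prod.sectR (⟨i⟩ : Discrete ℕ) Cᵒᵖ ⋙ L ≅ Prod.sectR (⟨i⟩ : Discrete ℕ) Cᵒᵖ ⋙ L') :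
    L ≅ L' :=
  NatIso.ofComponents (fun X ↦ (e X.1.as).app X.2) (by
    rintro ⟨⟨i⟩, X⟩ ⟨⟨j⟩, Y⟩ ⟨⟨⟨h⟩⟩, g⟩
    -- A morphism of the discrete category is an equality of degrees, so only naturality within one
    -- degree is left.
    obtain rfl : i = j := h
    exact (e i).hom.naturality g)

/-- The realization of a push-forward of the universal cohomology has the kernel of the functor
along which it is pushed forward. -/
lemma Cohomology.kernel_realization_push {F : AbUniv R C ⥤ B} (hF : IsExactLinear R F) :
    (((univ R C).push F).realization R).kernel = F.kernel :=
  -- The realization is a chosen functor, known only through isomorphisms in each degree. These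
  -- assemble to an isomorphism of restrictions to the generating category, and that determines the
  -- kernel.
  FreeAb.kernel_eq (((univ R C).push F).realization_isExactLinear R) hF
    (isoOfSectR fun i ↦ (((univ R C).push F).realization_push R i).some)

/-- The kernel of every admissible theory contains the Serre class, and one admissible theory
attains it: the push-forward of the universal cohomology to the Serre quotient. -/
lemma serre_eq_commonKernel (ax : Axioms (AbUniv R C)) :
    ax.serre =
      commonKernel {T : Theory.{w, v, u, max 1 w v u t, max 1 w v u s} R C | ax.Satisfied T.F} := by
  apply le_antisymm
  · intro X hX T hT
    have := (T.H.realization_isExactLinear R).left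
    have := (T.H.realization_isExactLinear R).right
    exact Axioms.serre_le_kernel T.F hT X hX
  · intro X hX
    obtain ⟨B', _, _, _, F, hF, hk⟩ := exists_exactLinear_kernel_eq.{w, _, _, max 1 w v u t, max 1 w v u s}
      (R := R) ax.serre
    let T : Theory.{w, v, u, max 1 w v u t, max 1 w v u s} R C := ⟨B', (univ R C).push F⟩
    have := (T.H.realization_isExactLinear R).left
    have := (T.H.realization_isExactLinear R).right
    have h : T.F.kernel = ax.serre := (Cohomology.kernel_realization_push hF).trans hk
    rw [← h]
    -- The kernel being known, `T` satisfies the axioms, so `X` lies in its kernel.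
    exact hX T (Axioms.satisfied_of_kernel_eq T.F h)

end Absolute

/-! ### The relative case -/

section Relative

variable {C : Type u} [Category.{v} C] {M : MorphismProperty C} [M.IsStableUnderComposition]
  {B : Type u'} [Category.{v'} B]

lemma RelDiagram.isoMk_naturality {L L' : RelDiagram M ⥤ B}
    (e : ∀ i, RelDiagram.H M i ⋙ L ≅ RelDiagram.H M i ⋙ L')
    (h : ∀ (i : ℕ) (t : Triple M), L.map (RelDiagram.δ i t) ≫ (e (i + 1)).hom.app (op t.XY) =
      (e i).hom.app (op t.YZ) ≫ L'.map (RelDiagram.δ i t)) {x y : RelVertex M} (a : x ⟶ y) :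
    (CategoryTheory.Quotient.functor (RelRelation M) ⋙ L).map ((Paths.of (RelVertex M)).map a) ≫
      ((e y.deg).app (op y.pair)).hom = ((e x.deg).app (op x.pair)).hom ≫
        (CategoryTheory.Quotient.functor (RelRelation M) ⋙ L').map
          ((Paths.of (RelVertex M)).map a) := by
  rcases a with ⟨i, f⟩ | ⟨i, t⟩
  · exact (e i).hom.naturality f.op
  · exact h i t

/-- Functors on the diagram category of relative cohomologies can be compared on the structure
maps. -/
def RelDiagram.isoMk {L L' : RelDiagram M ⥤ B}
    (e : ∀ i, RelDiagram.H M i ⋙ L ≅ RelDiagram.H M i ⋙ L')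
    (h : ∀ (i : ℕ) (t : Triple M), L.map (RelDiagram.δ i t) ≫ (e (i + 1)).hom.app (op t.XY) =
      (e i).hom.app (op t.YZ) ≫ L'.map (RelDiagram.δ i t)) : L ≅ L' :=
  CategoryTheory.Quotient.natIsoLift _ (NatIso.ofComponents
    (fun x : RelVertex M ↦ (e x.deg).app (op x.pair)) (by
      intro x y p
      -- The path category is free, so naturality propagates from the structure maps to all paths.
      -- The relations play no role here: an isomorphism of functors on the path category descends
      -- to the quotient.
      induction p using Paths.induction with
      | id =>
        rw [CategoryTheory.Functor.map_id, CategoryTheory.Functor.map_id]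
        exact (id_comp _).trans (comp_id _).symm
      | comp p a hp =>
        rw [Functor.map_comp, Functor.map_comp]
        exact (assoc _ _ _).trans ((congrArg (_ ≫ ·) (isoMk_naturality e h a)).trans
          ((assoc _ _ _).symm.trans ((congrArg (· ≫ _) hp).trans (assoc _ _ _))))))

variable {R : Type w} [CommRing R] [Abelian B] [Linear R B]

/-- After composition with the projection from the free abelian category both functors are exact,
linear and isomorphic on structure maps, so `FreeAb.kernel_eq` applies. The compatibility with
boundaries in `IsIsomorphic` is essential, since boundaries are among the generators. -/
lemma RelCohomology.kernel_realization_push {F : RelAbUniv M R ⥤ B} (hF : IsExactLinear R F) :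
    haveI := hF.left
    haveI := hF.right
    (((relUniv M R).push F).realization R).kernel = F.kernel := by
  have := hF.left
  have := hF.right
  have hG := ((relUniv M R).push F).realization_isExactLinear R
  obtain ⟨e, he⟩ := ((relUniv M R).push F).realization_push R
  have h := FreeAb.kernel_eq ((SerreQuotient.isExactLinear_proj _).comp hG)
    ((SerreQuotient.isExactLinear_proj _).comp hF) (RelDiagram.isoMk e he)
  ext X
  -- The projection to the localization is surjective on objects, so equality of kernels descends
  -- from the free abelian category.
  obtain ⟨X, rfl⟩ : ∃ Y, (RelAbUniv.proj M R).obj Y = X := ⟨X.as.obj, rfl⟩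
  exact Iff.of_eq (congrFun h X)

/-- As in the absolute case, the bound is attained by the push-forward of the universal theory to
the Serre quotient. That push-forward is a relative cohomology because the projection is exact. -/
lemma serre_eq_relCommonKernel (ax : Axioms (RelAbUniv M R)) :
    ax.serre = relCommonKernel
      {T : RelTheory.{w, v, u, max 1 w v u t, max 1 w v u s} M R | ax.Satisfied T.F} := by
  apply le_antisymm
  · intro X hX T hT
    exact Axioms.serre_le_kernel T.F hT X hX
  · intro X hX
    obtain ⟨B', _, _, _, F, hF, hk⟩ := exists_exactLinear_kernel_eq.{w, _, _, max 1 w v u t, max 1 w v u s}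
      (R := R) ax.serre
    have := hF.left
    have := hF.right
    let T : RelTheory.{w, v, u, max 1 w v u t, max 1 w v u s} M R := ⟨B', (relUniv M R).push F⟩
    have h : T.F.kernel = ax.serre := (RelCohomology.kernel_realization_push hF).trans hk
    rw [← h]
    exact hX T (Axioms.satisfied_of_kernel_eq T.F h)

end Relative

/-! ### Comparison of the quotients, and the proposition -/

lemma SerreQuotient.exists_equivalence_of_eq {R : Type w} [CommRing R] {A : Type u}
    [Category.{v} A] [Abelian A] [Linear R A] {P Q : ObjectProperty A} [P.IsSerreClass]
    [Q.IsSerreClass] (h : P = Q) : ∃ e : SerreQuotient P ≌ SerreQuotient Q,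
      SerreQuotient.proj P ⋙ e.functor = SerreQuotient.proj Q ∧ e.functor.Linear R := by
  subst h
  -- Once the two classes are identified the equivalence is the identity, so compatibility with the
  -- projections is an equality of functors.
  exact ⟨.refl, rfl, inferInstanceAs ((𝟭 (SerreQuotient P)).Linear R)⟩

end UniversalCohomology

end

theorem proposition1p4 {R : Type w} [CommRing R] {C : Type u} [Category.{v} C] :
    (∀ (ax : Axioms (AbUniv R C))
      (S : Set (Theory.{w, v, u, max 1 w v u t, max 1 w v u s} R C)),
      S = {T | ax.Satisfied T.F} →
        ax.serre = commonKernel S ∧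
        ∃ e : SerreQuotient ax.serre ≌ SerreQuotient (commonKernel S),
          SerreQuotient.proj ax.serre ⋙ e.functor = SerreQuotient.proj (commonKernel S) ∧
          e.functor.Linear R) ∧
    (∀ (M : MorphismProperty C) [M.IsStableUnderComposition]
      (ax : Axioms (RelAbUniv M R))
      (S : Set (RelTheory.{w, v, u, max 1 w v u t, max 1 w v u s} M R)),
      S = {T | ax.Satisfied T.F} →
        ax.serre = relCommonKernel S ∧
        ∃ e : SerreQuotient ax.serre ≌ SerreQuotient (relCommonKernel S),
          SerreQuotient.proj ax.serre ⋙ e.functor = SerreQuotient.proj (relCommonKernel S) ∧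
          e.functor.Linear R) := by
  refine ⟨?_, ?_⟩
  · rintro ax _ rfl
    have h := serre_eq_commonKernel.{w, v, u, t, s} ax
    exact ⟨h, SerreQuotient.exists_equivalence_of_eq h⟩
  · rintro M _ ax _ rfl
    have h := serre_eq_relCommonKernel.{w, v, u, t, s} ax
    exact ⟨h, SerreQuotient.exists_equivalence_of_eq h⟩
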